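/- Let $n \ge 2$ and let $U \subset \mathbb{R}^n$ be a non-empty bounded convex open set with smooth boundary. Let $p, q \in (1,\infty)$ be such that $p \ge \frac{n}{n-1}$ and $q > \frac{n}{2}$. Let $r \in [1,\infty]$; assume that $\frac1r \ge \frac1p - \frac1n$ if $p < n$, and that $r < \infty$ if $p = n$. Then there exists a constant $c' > 0$, depending only on $U, p, q, r$, such that for every $\omega \in L^q(U,\mathbb{R})$ with $\omega \ge 0$ a.e. and $\int_U \omega\,dx = 1$, and for every $f \in W^{1,p}(U,\mathbb{R})$, with weak differential $df$, the function $f\omega$ is integrable on $U$ and, with $\mathbb{E}_\omega[f] = \int_U f\,\omega\,dx$, \[ \left\| f - \mathbb{E}_\omega[f] \right\|_{L^r(U)} \le c'\, \|\omega\|_{L^q(U)}^{\frac{n}{(n-1)p}}\, \|df\|_{L^p(U)}, \] where $L^q(U)$, $L^r(U)$ and $L^p(U)$ are taken with respect to Lebesgue measure on $U$. -/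

import Mathlib

open MeasureTheory
open scoped ENNReal

section

open scoped ContDiff

/-- The open set `U ⊆ ℝⁿ` has smooth (`C^∞`) boundary: near each boundary point, `U` is the
sublevel set `{ρ < 0}` of a smooth function `ρ` whose differential does not vanish there. -/
def HasSmoothBoundary {n : ℕ} (U : Set (EuclideanSpace ℝ (Fin n))) : Prop :=
  ∀ x₀ ∈ frontier U, ∃ (V : Set (EuclideanSpace ℝ (Fin n)))
    (ρ : EuclideanSpace ℝ (Fin n) → ℝ), IsOpen V ∧ x₀ ∈ V ∧ ContDiffOn ℝ ∞ ρ V ∧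
      fderiv ℝ ρ x₀ ≠ 0 ∧ ∀ x ∈ V, x ∈ U ↔ ρ x < 0

/-- `df` is the weak (distributional) differential of `f` on the open set `U ⊆ ℝⁿ`:
`f` and `df` are locally integrable on `U` and
`∫_U f ∂_v φ = - ∫_U df(v) φ` for every test function `φ ∈ C_c^∞(U)` and every vector `v`. -/
structure HasWeakDeriv {n : ℕ} (U : Set (EuclideanSpace ℝ (Fin n)))
    (f : EuclideanSpace ℝ (Fin n) → ℝ)
    (df : EuclideanSpace ℝ (Fin n) → (EuclideanSpace ℝ (Fin n) →L[ℝ] ℝ)) : Prop where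
  locallyIntegrableOn : LocallyIntegrableOn f U volume
  locallyIntegrableOn_deriv : LocallyIntegrableOn df U volume
  integral_eq : ∀ φ : EuclideanSpace ℝ (Fin n) → ℝ, ContDiff ℝ ∞ φ → HasCompactSupport φ →
    tsupport φ ⊆ U → ∀ v : EuclideanSpace ℝ (Fin n),
      ∫ x in U, f x * fderiv ℝ φ x v = - ∫ x in U, df x v * φ x

/-- `f` belongs to the Sobolev space `W^{1,p}(U)`, and `df` is its weak differential:
`f ∈ L^p(U)`, `df` is the weak differential of `f` on `U`, and `df ∈ L^p(U)`.
The norm of `df x` is the dual norm of the Euclidean norm. -/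
structure MemW1pWithDeriv {n : ℕ} (U : Set (EuclideanSpace ℝ (Fin n))) (p : ℝ≥0∞)
    (f : EuclideanSpace ℝ (Fin n) → ℝ)
    (df : EuclideanSpace ℝ (Fin n) → (EuclideanSpace ℝ (Fin n) →L[ℝ] ℝ)) : Prop where
  memLp : MemLp f p (volume.restrict U)
  hasWeakDeriv : HasWeakDeriv U f df
  memLp_deriv : MemLp df p (volume.restrict U)

end

/-! Everything rests on a Sobolev–Poincaré inequality `‖f - c‖ ≤ K ‖df‖_p` with some constant `c`
depending on `f`; the density enters only when `c` is replaced by the weighted mean.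

For `C¹` functions on a convex set `V`, integrating along segments bounds `∫_V |f x - f y| dy` by an
average over `t ∈ (0,1)` of `t⁻ⁿ ∫_{B(x,tD)} |df|`. The ball integral is controlled by the maximal
function and, by Hölder, by `‖df‖_p`. Hedberg's splitting of the `t`-integral combines the two
bounds, and the strong maximal inequality gives the Sobolev exponent when `p < n`; when `p > n`
Hölder alone gives a sup bound (`exists_const_eLpNorm_sub_le_of_contDiff`). The constant depends
only on a diameter bound and a lower volume bound, hence is uniform over the inner parallel sets of
`U`. Mollifying there and passing to the limit gives `exists_const_eLpNorm_sub_le_of_convex`; the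
case `p = n` follows by lowering `p`.

Finally put `s = p(n-1)/n`. Jensen and Hölder (`lintegral_enorm_mul_enorm_le_of_density`) give
`|E_ω[f] - c| ≤ ‖ω‖_q^{1/s} ‖f - c‖_{s q'}`, and the assumptions on `p` and `q` put `s q'` within
the Sobolev range. The part `‖f - c‖_r` carries no power of `ω`, but `∫ ω = 1` bounds `‖ω‖_q` from
below, so that power can be inserted. -/

open Set Metric Module Filter
open scoped Topology Convolution

/-! ### The maximal function: weak and strong type estimates. -/

section MaximalFunction

/-- The centred maximal function of `g` over the balls with radii `ρ k`. -/
noncomputable def radialMaximal {E : Type*} [PseudoMetricSpace E] [MeasurableSpace E]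
    (μ : Measure E) (ρ : ℕ → ℝ) (g : E → ℝ≥0∞) (x : E) : ℝ≥0∞ :=
  ⨆ k, (∫⁻ y in ball x (ρ k), g y ∂μ) / μ (ball x (ρ k))

lemma radialMaximal_le_of_le {E : Type*} [PseudoMetricSpace E] [MeasurableSpace E] (μ : Measure E)
    {ρ : ℕ → ℝ} {g : E → ℝ≥0∞} {B : ℝ≥0∞} (hgB : ∀ x, g x ≤ B)
    (x : E) : radialMaximal μ ρ g x ≤ B := by
  refine iSup_le fun k => ENNReal.div_le_of_le_mul ?_
  calc ∫⁻ y in ball x (ρ k), g y ∂μ ≤ ∫⁻ y in ball x (ρ k), B ∂μ := lintegral_mono fun y => hgB y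
    _ = _ := by simp

variable {E : Type*} [NormedAddCommGroup E] [NormedSpace ℝ E] [FiniteDimensional ℝ E]
  [MeasurableSpace E] [BorelSpace E]

variable (μ : Measure E) [μ.IsAddHaarMeasure]

lemma measurable_setLIntegral_ball {g : E → ℝ≥0∞} (hg : Measurable g) :
    Measurable fun z : E × ℝ => ∫⁻ y in ball z.1 z.2, g y ∂μ := by
  have h : ∀ z : E × ℝ, ∫⁻ y in ball z.1 z.2, g y ∂μ =
      ∫⁻ y, {w : (E × ℝ) × E | dist w.2 w.1.1 < w.1.2}.indicator (fun w => g w.2) (z, y) ∂μ := by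
    intro z
    rw [← lintegral_indicator measurableSet_ball]
    rfl
  simp_rw [h]
  refine Measurable.lintegral_prod_right' (f := fun w : (E × ℝ) × E =>
    {w : (E × ℝ) × E | dist w.2 w.1.1 < w.1.2}.indicator (fun w => g w.2) w) ?_
  refine (hg.comp measurable_snd).indicator ?_
  exact measurableSet_lt (by fun_prop) (by fun_prop)

lemma measurable_radialMaximal (ρ : ℕ → ℝ) {g : E → ℝ≥0∞} (hg : Measurable g) :
    Measurable (radialMaximal μ ρ g) := by
  refine Measurable.iSup fun k => ?_
  simp_rw [Measure.addHaar_ball_center μ _ (ρ k)]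
  exact ((measurable_setLIntegral_ball μ hg).comp (measurable_id.prodMk measurable_const)).div_const _

/-- Weak type `(1,1)` estimate. -/
lemma mul_measure_lt_radialMaximal_le {ρ : ℕ → ℝ} {R : ℝ} (hρ : ∀ k, 0 < ρ k) (hR : ∀ k, ρ k ≤ R)
    (g : E → ℝ≥0∞) (t : ℝ≥0∞) :
    t * μ {x | t < radialMaximal μ ρ g x} ≤
      ENNReal.ofReal (4 ^ finrank ℝ E) * ∫⁻ y, g y ∂μ := by
  set S := {x | t < radialMaximal μ ρ g x}
  -- Membership in `S` sits under the existential so that `k` is total; off `S` its value is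
  -- irrelevant.
  have hS : ∀ x : E, ∃ k, x ∈ S → t * μ (ball x (ρ k)) ≤ ∫⁻ y in ball x (ρ k), g y ∂μ := by
    intro x
    by_cases hx : x ∈ S
    · obtain ⟨k, hk⟩ := lt_iSup_iff.1 (show t < ⨆ k, _ from hx)
      exact ⟨k, fun _ => (ENNReal.le_div_iff_mul_le (Or.inl (measure_ball_pos μ x (hρ k)).ne')
        (Or.inl measure_ball_lt_top.ne)).1 hk.le⟩
    · exact ⟨0, fun h => absurd h hx⟩
  choose k hk using hS
  -- Any enlargement factor above 3 works in Vitali's lemma; taking 4 is the source of `4 ^ finrank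
  -- ℝ E`.
  obtain ⟨u, huS, hdisj, hcov⟩ := Vitali.exists_disjoint_subfamily_covering_enlargement_ball S
    (fun x => x) (fun x => ρ (k x)) R (fun x _ => hR _) 4 (by norm_num)
  have hcount : u.Countable := hdisj.countable_of_isOpen (fun _ _ => isOpen_ball)
    (fun a _ => ⟨a, mem_ball_self (hρ _)⟩)
  have hsub : S ⊆ ⋃ b ∈ u, ball b (4 * ρ (k b)) := by
    intro a ha
    obtain ⟨b, hb, hab⟩ := hcov a ha
    exact mem_biUnion hb (hab (mem_ball_self (hρ _)))
  have hball : ∀ b : E, μ (ball b (4 * ρ (k b))) =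
      ENNReal.ofReal (4 ^ finrank ℝ E) * μ (ball b (ρ (k b))) := by
    intro b
    rw [Measure.addHaar_ball_of_pos μ b (by have := hρ (k b); positivity),
      Measure.addHaar_ball_of_pos μ b (hρ (k b)), mul_pow,
      ENNReal.ofReal_mul (by positivity), mul_assoc]
  have := hcount.to_subtype
  calc t * μ S ≤ t * ∑' b : u, μ (ball (b : E) (4 * ρ (k b))) := by
        gcongr
        exact (measure_mono hsub).trans (measure_biUnion_le μ hcount _)
    _ = ENNReal.ofReal (4 ^ finrank ℝ E) * ∑' b : u, t * μ (ball (b : E) (ρ (k b))) := by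
        simp_rw [hball]
        rw [ENNReal.tsum_mul_left, ENNReal.tsum_mul_left]
        ring
    _ ≤ ENNReal.ofReal (4 ^ finrank ℝ E) * ∑' b : u, ∫⁻ y in ball (b : E) (ρ (k b)), g y ∂μ := by
        gcongr with b
        exact hk b (huS b.2)
    _ = ENNReal.ofReal (4 ^ finrank ℝ E) * ∫⁻ y in ⋃ b ∈ u, ball b (ρ (k b)), g y ∂μ := by
        rw [lintegral_biUnion hcount (fun _ _ => measurableSet_ball) hdisj]
    _ ≤ _ := by
        gcongr
        exact Measure.restrict_le_self

omit [BorelSpace E] in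
lemma radialMaximal_add_const_le {ρ : ℕ → ℝ} (hρ : ∀ k, 0 < ρ k) {g h : E → ℝ≥0∞} {c : ℝ≥0∞}
    (hh : Measurable h)
    (hgh : ∀ x, g x ≤ h x + c) (x : E) : radialMaximal μ ρ g x ≤ radialMaximal μ ρ h x + c := by
  refine iSup_le fun k => ?_
  have h0 : μ (ball x (ρ k)) ≠ 0 := (measure_ball_pos μ x (hρ k)).ne'
  have h1 : μ (ball x (ρ k)) ≠ ∞ := measure_ball_lt_top.ne
  calc (∫⁻ y in ball x (ρ k), g y ∂μ) / μ (ball x (ρ k))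
      ≤ (∫⁻ y in ball x (ρ k), (h y + c) ∂μ) / μ (ball x (ρ k)) := by
        gcongr with y
        exact hgh y
    _ = (∫⁻ y in ball x (ρ k), h y ∂μ) / μ (ball x (ρ k)) + c := by
        rw [lintegral_add_left hh, setLIntegral_const, ENNReal.add_div,
          ENNReal.mul_div_cancel_right h0 h1]
    _ ≤ _ := by
        gcongr
        exact le_iSup (fun k => (∫⁻ y in ball x (ρ k), h y ∂μ) / μ (ball x (ρ k))) k

/-- The part of `g` not exceeding `t / 2` contributes at most `t / 2` to the maximal function, so
the truncation to `A` must exceed level `t / 2`; the weak estimate at that level costs the factor 2.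
-/
lemma mul_measure_lt_radialMaximal_le_truncated {ρ : ℕ → ℝ} {R : ℝ} (hρ : ∀ k, 0 < ρ k)
    (hR : ∀ k, ρ k ≤ R) {g : E → ℝ≥0∞} (hg : Measurable g) (t : ℝ≥0∞) :
    t * μ {x | t < radialMaximal μ ρ g x} ≤
      2 * ENNReal.ofReal (4 ^ finrank ℝ E) * ∫⁻ y in {y | t / 2 < g y}, g y ∂μ := by
  set A := {y | t / 2 < g y}
  have hA : MeasurableSet A := measurableSet_lt measurable_const hg
  have hsub : {x | t < radialMaximal μ ρ g x} ⊆
      {x | t / 2 < radialMaximal μ ρ (A.indicator g) x} := by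
    intro x hx
    have h1 := radialMaximal_add_const_le μ hρ (g := g) (h := A.indicator g) (c := t / 2)
      (hg.indicator hA) (fun y => by
        by_cases hy : y ∈ A
        · simp [hy]
        · simpa [hy] using not_lt.1 hy) x
    by_contra hcon
    have h2 : radialMaximal μ ρ g x ≤ t / 2 + t / 2 := h1.trans (by gcongr; exact not_lt.1 hcon)
    rw [ENNReal.add_halves] at h2
    exact absurd hx (not_lt.2 h2)
  calc t * μ {x | t < radialMaximal μ ρ g x}
      ≤ t * μ {x | t / 2 < radialMaximal μ ρ (A.indicator g) x} := by gcongr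
    _ = 2 * (t / 2 * μ {x | t / 2 < radialMaximal μ ρ (A.indicator g) x}) := by
        rw [← mul_assoc, ENNReal.mul_div_cancel (by simp) (by simp)]
    _ ≤ 2 * (ENNReal.ofReal (4 ^ finrank ℝ E) * ∫⁻ y, A.indicator g y ∂μ) := by
        gcongr 2 * ?_
        exact mul_measure_lt_radialMaximal_le μ hρ hR _ _
    _ = _ := by rw [lintegral_indicator hA, mul_assoc]

lemma setLIntegral_Ioo_rpow {s b : ℝ} (hs : -1 < s) (hb : 0 ≤ b) :
    ∫⁻ t in Ioo 0 b, ENNReal.ofReal (t ^ s) = ENNReal.ofReal (b ^ (s + 1) / (s + 1)) := by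
  rw [restrict_Ioo_eq_restrict_Ioc, ← ofReal_integral_eq_lintegral_ofReal,
    ← intervalIntegral.integral_of_le hb, integral_rpow (Or.inl hs),
    Real.zero_rpow (by linarith), sub_zero]
  · exact (intervalIntegral.intervalIntegrable_rpow' hs).1
  · filter_upwards [ae_restrict_mem measurableSet_Ioc] with t ht
    exact Real.rpow_nonneg ht.1.le _

/-- A function `F` satisfying a truncated weak type estimate against `g` satisfies a strong
type estimate. -/
lemma lintegral_rpow_le_of_mul_measure_lt_le {α : Type*} [MeasurableSpace α] {ν : Measure α}
    [SFinite ν] {F g : α → ℝ} (hF0 : 0 ≤ F) (hg0 : 0 ≤ g) (hF : Measurable F) (hg : Measurable g)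
    {C : ℝ≥0∞}
    (h : ∀ t : ℝ, 0 < t → ENNReal.ofReal t * ν {x | t < F x} ≤
      C * ∫⁻ x in {x | t / 2 < g x}, ENNReal.ofReal (g x) ∂ν) {p : ℝ} (hp : 1 < p) :
    ∫⁻ x, ENNReal.ofReal (F x ^ p) ∂ν ≤
      ENNReal.ofReal (p * (2 ^ (p - 1) / (p - 1))) * C * ∫⁻ x, ENNReal.ofReal (g x ^ p) ∂ν := by
  have hmeas : MeasurableSet {w : ℝ × α | w.1 < 2 * g w.2} :=
    measurableSet_lt measurable_fst ((hg.comp measurable_snd).const_mul 2)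
  -- By the layer-cake formula the left side is `p ∫ t^(p-1) ν{F > t} dt`, dominated through `h` by
  -- the double integral of `Φ`. In the other order, the integral of `t^(p-2)` over `(0, 2 g x)`
  -- converges because `p > 1`.
  set Φ : ℝ × α → ℝ≥0∞ := {w : ℝ × α | w.1 < 2 * g w.2}.indicator
    fun w => ENNReal.ofReal (g w.2) * ENNReal.ofReal (w.1 ^ (p - 2)) with hΦ
  have hΦm : Measurable Φ := by
    refine Measurable.indicator ?_ hmeas
    exact (hg.comp measurable_snd).ennreal_ofReal.mul
      (measurable_fst.pow_const _).ennreal_ofReal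
  have h1 : ∀ t ∈ Ioi (0 : ℝ), ν {x | t < F x} * ENNReal.ofReal (t ^ (p - 1)) ≤
      C * ∫⁻ x, Φ (t, x) ∂ν := by
    intro t ht
    have ht' : (0 : ℝ) < t := ht
    have e1 : ENNReal.ofReal (t ^ (p - 1)) = ENNReal.ofReal t * ENNReal.ofReal (t ^ (p - 2)) := by
      rw [← ENNReal.ofReal_mul ht'.le]
      congr 1
      rw [show p - 1 = 1 + (p - 2) by ring, Real.rpow_add ht', Real.rpow_one]
    have e2 : ∫⁻ x, Φ (t, x) ∂ν =
        (∫⁻ x in {x | t / 2 < g x}, ENNReal.ofReal (g x) ∂ν) * ENNReal.ofReal (t ^ (p - 2)) := by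
      rw [← lintegral_indicator (measurableSet_lt measurable_const hg),
        ← lintegral_mul_const _ (hg.ennreal_ofReal.indicator
          (measurableSet_lt measurable_const hg))]
      congr 1 with x
      by_cases hx : t < 2 * g x
      · have hx' : t / 2 < g x := by linarith
        simp [hΦ, hx, hx']
      · have hx' : ¬ t / 2 < g x := by intro h; exact hx (by linarith)
        simp [hΦ, hx, hx']
    rw [e1, e2, ← mul_assoc, ← mul_assoc, mul_comm (ν _)]
    gcongr ?_ * _
    exact h t ht'
  have h2 : ∀ x, ∫⁻ t in Ioi (0 : ℝ), Φ (t, x) =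
      ENNReal.ofReal (2 ^ (p - 1) / (p - 1)) * ENNReal.ofReal (g x ^ p) := by
    intro x
    have hgx : 0 ≤ g x := hg0 x
    have e1 : ∀ t, Φ (t, x) = (Iio (2 * g x)).indicator
        (fun t => ENNReal.ofReal (g x) * ENNReal.ofReal (t ^ (p - 2))) t := fun t => rfl
    simp_rw [e1]
    rw [setLIntegral_indicator measurableSet_Iio, inter_comm, Ioi_inter_Iio,
      lintegral_const_mul _ (by fun_prop), setLIntegral_Ioo_rpow (by linarith) (by linarith),
      ← ENNReal.ofReal_mul hgx,
      ← ENNReal.ofReal_mul (by have : 0 < p - 1 := by linarith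
                               positivity)]
    congr 1
    rw [show p - 2 + 1 = p - 1 by ring, Real.mul_rpow (by norm_num) hgx]
    rcases hgx.eq_or_lt with h0 | h0
    · rw [← h0, Real.zero_rpow (by linarith : p - 1 ≠ 0), Real.zero_rpow (by linarith : p ≠ 0)]
      simp
    · rw [show g x ^ p = g x * g x ^ (p - 1) by
        conv_rhs => rw [← Real.rpow_one_add' hgx (by linarith)]
        congr 1; ring]
      ring
  rw [lintegral_rpow_eq_lintegral_meas_lt_mul ν (Filter.Eventually.of_forall hF0) hF.aemeasurable
    (by linarith)]
  calc ENNReal.ofReal p * ∫⁻ t in Ioi (0 : ℝ), ν {x | t < F x} * ENNReal.ofReal (t ^ (p - 1))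
      ≤ ENNReal.ofReal p * ∫⁻ t in Ioi (0 : ℝ), C * ∫⁻ x, Φ (t, x) ∂ν := by
        gcongr _ * ?_
        exact setLIntegral_mono' measurableSet_Ioi h1
    _ = ENNReal.ofReal p * (C * ∫⁻ x, (∫⁻ t in Ioi (0 : ℝ), Φ (t, x)) ∂ν) := by
        rw [lintegral_const_mul _ hΦm.lintegral_prod_right',
          lintegral_lintegral_swap (f := fun t x => Φ (t, x)) hΦm.aemeasurable]
    _ = _ := by
        simp_rw [h2]
        rw [lintegral_const_mul _ (hg.pow_const p).ennreal_ofReal, ENNReal.ofReal_mul (by linarith)]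
        ring

/-- Strong type `(p,p)` estimate for bounded functions. -/
lemma lintegral_radialMaximal_rpow_le {ρ : ℕ → ℝ} {R : ℝ} (hρ : ∀ k, 0 < ρ k)
    (hR : ∀ k, ρ k ≤ R) {g : E → ℝ≥0∞} (hg : Measurable g) {B : ℝ≥0∞} (hB : B ≠ ∞)
    (hgB : ∀ x, g x ≤ B) {p : ℝ} (hp : 1 < p) :
    ∫⁻ x, radialMaximal μ ρ g x ^ p ∂μ ≤
      ENNReal.ofReal (p * (2 ^ (p - 1) / (p - 1))) * (2 * ENNReal.ofReal (4 ^ finrank ℝ E)) *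
        ∫⁻ x, g x ^ p ∂μ := by
  -- Boundedness makes both functions finite, which lets the real-valued estimate apply; `B` does
  -- not enter the constant.
  have hMB := radialMaximal_le_of_le μ (ρ := ρ) hgB
  have hM : ∀ x, radialMaximal μ ρ g x ≠ ∞ := fun x => ((hMB x).trans_lt hB.lt_top).ne
  have hgf : ∀ x, g x ≠ ∞ := fun x => ((hgB x).trans_lt hB.lt_top).ne
  have key := lintegral_rpow_le_of_mul_measure_lt_le (ν := μ)
    (F := fun x => (radialMaximal μ ρ g x).toReal) (g := fun x => (g x).toReal)
    (C := 2 * ENNReal.ofReal (4 ^ finrank ℝ E))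
    (fun _ => ENNReal.toReal_nonneg) (fun _ => ENNReal.toReal_nonneg)
    (measurable_radialMaximal μ ρ hg).ennreal_toReal hg.ennreal_toReal
    (fun t ht => by
      have := mul_measure_lt_radialMaximal_le_truncated μ hρ hR hg (ENNReal.ofReal t)
      convert this using 5 with x
      · exact (ENNReal.ofReal_lt_iff_lt_toReal ht.le (hM x)).symm
      · ext x
        rw [← ENNReal.ofReal_lt_iff_lt_toReal (by positivity) (hgf x),
          ENNReal.ofReal_div_of_pos (by norm_num)]
        simp
      · rename_i x
        exact ENNReal.ofReal_toReal (hgf x)) hp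
  convert key using 3 with x x
  · rw [← ENNReal.ofReal_rpow_of_nonneg ENNReal.toReal_nonneg (by linarith),
      ENNReal.ofReal_toReal (hM x)]
  · ext x
    rw [← ENNReal.ofReal_rpow_of_nonneg ENNReal.toReal_nonneg (by linarith),
      ENNReal.ofReal_toReal (hgf x)]

end MaximalFunction

/-! ### Hedberg's splitting of the singular integral. -/

/-- If `A t` is controlled by both `t ^ d` and `t ^ (d - a)`, then the singular average of `A`
is controlled by a geometric mean of the two constants. -/
lemma setLIntegral_rpow_neg_mul_le_rpow_mul_rpow {A : ℝ → ℝ≥0∞} {d a : ℝ} (ha : 1 < a)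
    {M N : ℝ≥0∞} (hM : M ≠ ∞)
    (h1 : ∀ t ∈ Ioo (0 : ℝ) 1, A t ≤ ENNReal.ofReal (t ^ d) * M)
    (h2 : ∀ t ∈ Ioo (0 : ℝ) 1, A t ≤ ENNReal.ofReal (t ^ (d - a)) * N) :
    ∫⁻ t in Ioo (0 : ℝ) 1, ENNReal.ofReal (t ^ (-d)) * A t ≤
      ENNReal.ofReal (1 + 1 / (a - 1)) * (M ^ (1 - 1 / a) * N ^ (1 / a)) := by
  have ha0 : 0 < a := by linarith
  have hinv : 1 / a < 1 := (div_lt_one ha0).2 ha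
  have hinv0 : 0 < 1 / a := by positivity
  have hone : 1 ≤ ENNReal.ofReal (1 + 1 / (a - 1)) := by
    rw [← ENNReal.ofReal_one]
    apply ENNReal.ofReal_le_ofReal
    have : 0 < 1 / (a - 1) := by
      have : 0 < a - 1 := by linarith
      positivity
    linarith
  have b1 : ∀ t ∈ Ioo (0 : ℝ) 1, ENNReal.ofReal (t ^ (-d)) * A t ≤ M := by
    intro t ht
    calc _ ≤ ENNReal.ofReal (t ^ (-d)) * (ENNReal.ofReal (t ^ d) * M) := by
          gcongr; exact h1 t ht
      _ = M := by
          rw [← mul_assoc, ← ENNReal.ofReal_mul (Real.rpow_nonneg ht.1.le _),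
            ← Real.rpow_add ht.1]
          simp
  have b2 : ∀ t ∈ Ioo (0 : ℝ) 1,
      ENNReal.ofReal (t ^ (-d)) * A t ≤ ENNReal.ofReal (t ^ (-a)) * N := by
    intro t ht
    calc _ ≤ ENNReal.ofReal (t ^ (-d)) * (ENNReal.ofReal (t ^ (d - a)) * N) := by
          gcongr; exact h2 t ht
      _ = _ := by
          rw [← mul_assoc, ← ENNReal.ofReal_mul (Real.rpow_nonneg ht.1.le _),
            ← Real.rpow_add ht.1]
          congr 3; ring
  -- If `M ≤ N`, the trivial bound `M` is already below the geometric mean, and no splitting is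
  -- needed.
  rcases le_or_gt M N with hMN | hNM
  · calc ∫⁻ t in Ioo (0 : ℝ) 1, ENNReal.ofReal (t ^ (-d)) * A t
        ≤ ∫⁻ t in Ioo (0 : ℝ) 1, M := setLIntegral_mono' measurableSet_Ioo b1
      _ = M := by simp
      _ = M ^ (1 - 1 / a) * M ^ (1 / a) := by
          rw [← ENNReal.rpow_add_of_nonneg _ _ (by linarith) hinv0.le]; simp
      _ ≤ 1 * (M ^ (1 - 1 / a) * N ^ (1 / a)) := by
          rw [one_mul]; gcongr
      _ ≤ _ := by gcongr
  rcases eq_or_ne N 0 with rfl | hN0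
  · have : ∫⁻ t in Ioo (0 : ℝ) 1, ENNReal.ofReal (t ^ (-d)) * A t ≤
        ∫⁻ t in Ioo (0 : ℝ) 1, 0 :=
      setLIntegral_mono' measurableSet_Ioo (fun t ht => by simpa using b2 t ht)
    refine this.trans (by simp)
  have hN : N ≠ ∞ := hNM.ne_top
  lift M to NNReal using hM
  lift N to NNReal using hN
  have hn : (0 : ℝ) < N := by
    have : N ≠ 0 := by exact_mod_cast hN0
    positivity
  have hnm : (N : ℝ) < M := by exact_mod_cast hNM
  have hm : (0 : ℝ) < M := hn.trans hnm
  -- The bounds `M` and `t ^ (-a) * N` cross at `δ`, which lies in `(0,1)` since `N < M`. With this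
  -- choice both pieces are multiples of the same geometric mean.
  set δ : ℝ := (N / M : ℝ) ^ (1 / a) with hδ
  have hδ0 : 0 < δ := by positivity
  have hδ1 : δ < 1 := Real.rpow_lt_one (by positivity) ((div_lt_one hm).2 hnm) hinv0
  have hsplit : Ioo (0 : ℝ) 1 = Ioc 0 δ ∪ Ioo δ 1 := (Ioc_union_Ioo_eq_Ioo hδ0.le hδ1).symm
  have hsub1 : Ioc 0 δ ⊆ Ioo (0 : ℝ) 1 := fun t ht => ⟨ht.1, ht.2.trans_lt hδ1⟩
  have hsub2 : Ioo δ 1 ⊆ Ioo (0 : ℝ) 1 := fun t ht => ⟨hδ0.trans ht.1, ht.2⟩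
  have i2 : ∫⁻ t in Ioi δ, ENNReal.ofReal (t ^ (-a)) = ENNReal.ofReal (δ ^ (1 - a) / (a - 1)) := by
    rw [← ofReal_integral_eq_lintegral_ofReal (integrableOn_Ioi_rpow_of_lt (by linarith) hδ0),
      integral_Ioi_rpow_of_lt (by linarith) hδ0]
    · congr 1
      rw [show -a + 1 = -(a - 1) by ring, show 1 - a = -(a - 1) by ring, neg_div_neg_eq]
    · filter_upwards [ae_restrict_mem measurableSet_Ioi] with t ht
      exact Real.rpow_nonneg (hδ0.trans ht).le _
  have e1 : (M : ℝ) * δ = M ^ (1 - 1 / a) * N ^ (1 / a) := by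
    rw [hδ, Real.div_rpow hn.le hm.le, Real.rpow_sub hm, Real.rpow_one]
    field_simp
  have e2 : δ ^ (1 - a) * N = M ^ (1 - 1 / a) * N ^ (1 / a) := by
    have hh : δ ^ (1 - a) = (N : ℝ) ^ (1 / a - 1) / M ^ (1 / a - 1) := by
      rw [hδ, ← Real.rpow_mul (by positivity), Real.div_rpow hn.le hm.le]
      congr 2 <;> field_simp
    rw [hh, Real.rpow_sub hn, Real.rpow_sub hm, Real.rpow_sub hm]
    simp only [Real.rpow_one]
    field_simp
  calc ∫⁻ t in Ioo (0 : ℝ) 1, ENNReal.ofReal (t ^ (-d)) * A t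
      ≤ (∫⁻ t in Ioc 0 δ, ENNReal.ofReal (t ^ (-d)) * A t) +
        ∫⁻ t in Ioo δ 1, ENNReal.ofReal (t ^ (-d)) * A t := by
          rw [hsplit]; exact lintegral_union_le _ _ _
    _ ≤ (∫⁻ t in Ioc 0 δ, (M : ℝ≥0∞)) + ∫⁻ t in Ioi δ, ENNReal.ofReal (t ^ (-a)) * N := by
          refine add_le_add (setLIntegral_mono' measurableSet_Ioc fun t ht => b1 t (hsub1 ht)) ?_
          exact (setLIntegral_mono' measurableSet_Ioo fun t ht => b2 t (hsub2 ht)).trans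
            (lintegral_mono_set fun t ht => ht.1)
    _ = ENNReal.ofReal (M * δ) + ENNReal.ofReal (δ ^ (1 - a) * N / (a - 1)) := by
          rw [lintegral_mul_const _ (by fun_prop), i2, setLIntegral_const, Real.volume_Ioc, sub_zero,
            ENNReal.ofReal_mul hm.le, ENNReal.ofReal_coe_nnreal, mul_div_right_comm,
            ENNReal.ofReal_mul (div_nonneg (by positivity) (by linarith)),
            ENNReal.ofReal_coe_nnreal]
    _ = ENNReal.ofReal (1 + 1 / (a - 1)) * (M ^ (1 - 1 / a) * N ^ (1 / a)) := by
          rw [e1, e2, ← ENNReal.ofReal_add (by positivity)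
            (div_nonneg (by positivity) (by linarith)),
            show (M : ℝ) ^ (1 - 1 / a) * (N : ℝ) ^ (1 / a) +
              (M : ℝ) ^ (1 - 1 / a) * (N : ℝ) ^ (1 / a) / (a - 1) =
              (1 + 1 / (a - 1)) * ((M : ℝ) ^ (1 - 1 / a) * (N : ℝ) ^ (1 / a)) by ring,
            ENNReal.ofReal_mul (by
              have : 0 < a - 1 := by linarith
              positivity), ENNReal.ofReal_mul (by positivity),
            ← ENNReal.ofReal_rpow_of_pos hm, ← ENNReal.ofReal_rpow_of_pos hn,
            ENNReal.ofReal_coe_nnreal, ENNReal.ofReal_coe_nnreal]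

/-! ### Mean oscillation on convex sets and bounds for ball integrals. -/

section ConvexMeanOscillation

variable {E : Type*} [NormedAddCommGroup E] [NormedSpace ℝ E] [FiniteDimensional ℝ E]
  [MeasurableSpace E] [BorelSpace E] (μ : Measure E) [μ.IsAddHaarMeasure]

lemma lintegral_comp_homothety {h : E → ℝ≥0∞} (hh : Measurable h) (x : E) {t : ℝ} (ht : 0 < t) :
    ∫⁻ y, h (x + t • (y - x)) ∂μ =
      ENNReal.ofReal (t ^ (-(finrank ℝ E : ℝ))) * ∫⁻ z, h z ∂μ := by
  rw [lintegral_sub_right_eq_self (μ := μ) (fun y => h (x + t • y)) x]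
  have hm : Measurable fun y => h (x + y) := hh.comp (measurable_const_add x)
  have h2 := lintegral_map hm (measurable_const_smul (α := E) t) (μ := μ)
  rw [Measure.map_addHaar_smul μ ht.ne', lintegral_smul_measure,
    lintegral_add_left_eq_self (μ := μ) h x] at h2
  rw [← h2, abs_of_nonneg (by positivity), Real.rpow_neg ht.le, Real.rpow_natCast, smul_eq_mul]

/-- Mean oscillation of a `C¹` function on a convex set in terms of averages of its gradient on
balls. -/
lemma lintegral_enorm_sub_le_of_convex {V : Set E} (hV : MeasurableSet V) (hc : Convex ℝ V)
    {D : ℝ} (hD : ∀ x ∈ V, ∀ y ∈ V, dist x y < D) {f : E → ℝ} (hf : ContDiff ℝ 1 f)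
    {x : E} (hx : x ∈ V) :
    ∫⁻ y in V, ‖f x - f y‖ₑ ∂μ ≤ ENNReal.ofReal D *
      ∫⁻ t in Ioo (0 : ℝ) 1, ENNReal.ofReal (t ^ (-(finrank ℝ E : ℝ))) *
        ∫⁻ z in ball x (t * D), V.indicator (fun z => ‖fderiv ℝ f z‖ₑ) z ∂μ := by
  have hcont : Continuous (fderiv ℝ f) := hf.continuous_fderiv one_ne_zero
  set g : E → ℝ≥0∞ := V.indicator (fun z => ‖fderiv ℝ f z‖ₑ) with hg
  have hgm : Measurable g := hcont.measurable.enorm.indicator hV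
  set H : ℝ × E → ℝ≥0∞ := {w : ℝ × E | dist w.2 x < w.1 * D}.indicator (fun w => g w.2) with hH
  have hHm : Measurable H := by
    refine (hgm.comp measurable_snd).indicator ?_
    exact measurableSet_lt (by fun_prop) (by fun_prop)
  -- Fundamental theorem of calculus on the segment from `x` to `y`. By convexity the point at time
  -- `t` is in `V`, and it is within `t * D` of `x`, so inserting the indicators in `H` loses
  -- nothing.
  have hpt : ∀ y ∈ V, ‖f x - f y‖ₑ ≤
      ∫⁻ t in Ioo (0 : ℝ) 1, ENNReal.ofReal D * H (t, x + t • (y - x)) := by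
    intro y hy
    have hder : ∀ t : ℝ, HasDerivAt (fun t : ℝ => f (x + t • (y - x)))
        (fderiv ℝ f (x + t • (y - x)) (y - x)) t := by
      intro t
      have h1 : HasDerivAt (fun t : ℝ => x + t • (y - x)) (y - x) t := by
        simpa using ((hasDerivAt_id t).smul_const (y - x)).const_add x
      exact ((hf.differentiable one_ne_zero) _).hasFDerivAt.comp_hasDerivAt t h1
    have hint := intervalIntegral.integral_eq_sub_of_hasDerivAt (a := 0) (b := 1)
      (fun t _ => hder t) (Continuous.intervalIntegrable (by fun_prop) _ _)
    simp only [one_smul, zero_smul, add_zero, add_sub_cancel] at hint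
    rw [← enorm_neg, neg_sub, ← hint, intervalIntegral.integral_of_le zero_le_one,
      ← restrict_Ioo_eq_restrict_Ioc]
    refine (enorm_integral_le_lintegral_enorm _).trans ?_
    refine setLIntegral_mono' measurableSet_Ioo fun t ht => ?_
    have hmem : x + t • (y - x) ∈ V := hc.add_smul_sub_mem hx hy ⟨ht.1.le, ht.2.le⟩
    have hdist : dist (x + t • (y - x)) x < t * D := by
      rw [dist_eq_norm, add_sub_cancel_left, norm_smul, Real.norm_of_nonneg ht.1.le,
        ← dist_eq_norm]
      exact mul_lt_mul_of_pos_left (hD y hy x hx) ht.1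
    have hHv : H (t, x + t • (y - x)) = ‖fderiv ℝ f (x + t • (y - x))‖ₑ := by
      rw [hH, indicator_of_mem (by exact hdist), hg, indicator_of_mem hmem]
    rw [hHv, mul_comm]
    refine ((fderiv ℝ f (x + t • (y - x))).le_opENorm (y - x)).trans ?_
    gcongr
    rw [← ofReal_norm, ← dist_eq_norm]
    exact ENNReal.ofReal_le_ofReal (hD y hy x hx).le
  calc ∫⁻ y in V, ‖f x - f y‖ₑ ∂μ
      ≤ ∫⁻ y in V, (∫⁻ t in Ioo (0 : ℝ) 1, ENNReal.ofReal D * H (t, x + t • (y - x))) ∂μ :=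
        setLIntegral_mono' hV hpt
    _ ≤ ∫⁻ y, (∫⁻ t in Ioo (0 : ℝ) 1, ENNReal.ofReal D * H (t, x + t • (y - x))) ∂μ :=
        setLIntegral_le_lintegral _ _
    _ = ∫⁻ t in Ioo (0 : ℝ) 1, (∫⁻ y, ENNReal.ofReal D * H (t, x + t • (y - x)) ∂μ) := by
        rw [lintegral_lintegral_swap]
        refine Measurable.aemeasurable ?_
        refine Measurable.const_mul (hHm.comp ?_) _
        fun_prop
    _ = ∫⁻ t in Ioo (0 : ℝ) 1, ENNReal.ofReal D *
          (ENNReal.ofReal (t ^ (-(finrank ℝ E : ℝ))) * ∫⁻ z in ball x (t * D), g z ∂μ) := by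
        -- The substitution `z = x + t • (y - x)` has Jacobian `t ^ dim`, which produces the
        -- singular weight.
        refine setLIntegral_congr_fun measurableSet_Ioo fun t ht => ?_
        have hHt : Measurable fun z => H (t, z) := hHm.comp measurable_prodMk_left
        have e : ∫⁻ z, H (t, z) ∂μ = ∫⁻ z in ball x (t * D), g z ∂μ := by
          rw [← lintegral_indicator measurableSet_ball]
          rfl
        rw [lintegral_const_mul (f := fun y => H (t, x + t • (y - x))) _ (hHt.comp (by fun_prop)),
          lintegral_comp_homothety μ hHt x ht.1, e]
    _ = _ := by
        rw [lintegral_const_mul']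
        exact ENNReal.ofReal_ne_top

/-- Hölder against the constant 1; the power of `t` is that of the ball's volume raised to `1 - 1 /
p`. -/
lemma setLIntegral_ball_le_rpow_mul {g : E → ℝ≥0∞} (hg : Measurable g) {p : ℝ} (hp : 1 < p)
    (x : E) {D t : ℝ} (hD : 0 < D) (ht : 0 < t) :
    ∫⁻ z in ball x (t * D), g z ∂μ ≤
      ENNReal.ofReal (t ^ ((finrank ℝ E : ℝ) - finrank ℝ E / p)) *
        (μ (ball 0 D) ^ (1 - 1 / p) * (∫⁻ z, g z ^ p ∂μ) ^ (1 / p)) := by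
  have hpq := Real.HolderConjugate.conjExponent hp
  have h := ENNReal.lintegral_mul_le_Lp_mul_Lq (μ.restrict (ball x (t * D))) hpq
    hg.aemeasurable (g := fun _ => 1) aemeasurable_const
  have hq : 1 / p.conjExponent = 1 - 1 / p := by
    have := hpq.one_sub_inv
    rw [one_div, one_div, this]
  simp only [Pi.mul_apply, mul_one, ENNReal.one_rpow, lintegral_const, one_mul,
    Measure.restrict_apply_univ, hq] at h
  have hb : μ (ball x (t * D)) = ENNReal.ofReal (t ^ (finrank ℝ E : ℝ)) * μ (ball 0 D) := by
    rw [Measure.addHaar_ball_of_pos μ x (by positivity),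
      Measure.addHaar_ball_of_pos μ 0 hD, mul_pow, ENNReal.ofReal_mul (by positivity), mul_assoc,
      Real.rpow_natCast]
  have hp1 : 0 ≤ 1 - 1 / p := by
    rw [sub_nonneg, div_le_one (by linarith)]; exact hp.le
  calc _ ≤ _ := h
    _ ≤ (∫⁻ z, g z ^ p ∂μ) ^ (1 / p) * μ (ball x (t * D)) ^ (1 - 1 / p) := by
        gcongr
        exact Measure.restrict_le_self
    _ = _ := by
        rw [hb, ENNReal.mul_rpow_of_nonneg _ _ hp1,
          ENNReal.ofReal_rpow_of_pos (by positivity), ← Real.rpow_mul ht.le,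
          show (finrank ℝ E : ℝ) * (1 - 1 / p) = finrank ℝ E - finrank ℝ E / p by ring]
        ring

/-- Dyadic radii suffice: the smallest dyadic radius above `t * D` is at most twice as large, whence
`2 * D` in the constant. -/
lemma setLIntegral_ball_le_radialMaximal (g : E → ℝ≥0∞) (x : E) {D t : ℝ} (hD : 0 < D)
    (ht : t ∈ Ioo (0 : ℝ) 1) :
    ∫⁻ z in ball x (t * D), g z ∂μ ≤ ENNReal.ofReal (t ^ (finrank ℝ E : ℝ)) *
      (μ (ball 0 (2 * D)) * radialMaximal μ (fun k => (1 / 2) ^ k * D) g x) := by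
  obtain ⟨k, hk1, hk2⟩ := exists_nat_pow_near_of_lt_one ht.1 ht.2.le
    (show (0 : ℝ) < 1 / 2 by norm_num) (by norm_num)
  have hpos : 0 < (1 / 2 : ℝ) ^ k * D := by positivity
  have h0 : μ (ball x ((1 / 2 : ℝ) ^ k * D)) ≠ 0 := (measure_ball_pos μ x hpos).ne'
  have hle : μ (ball x ((1 / 2 : ℝ) ^ k * D)) ≤
      ENNReal.ofReal (t ^ (finrank ℝ E : ℝ)) * μ (ball 0 (2 * D)) := by
    have : μ (ball x (t * (2 * D))) =
        ENNReal.ofReal (t ^ (finrank ℝ E : ℝ)) * μ (ball 0 (2 * D)) := by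
      have := ht.1
      rw [Measure.addHaar_ball_of_pos μ x (by positivity),
        Measure.addHaar_ball_of_pos μ 0 (show 0 < 2 * D by positivity), mul_pow,
        ENNReal.ofReal_mul (by positivity), mul_assoc, Real.rpow_natCast]
    rw [← this]
    refine measure_mono (ball_subset_ball ?_)
    rw [pow_succ] at hk1
    nlinarith
  calc ∫⁻ z in ball x (t * D), g z ∂μ ≤ ∫⁻ z in ball x ((1 / 2) ^ k * D), g z ∂μ :=
        lintegral_mono_set (ball_subset_ball (by gcongr))
    _ = μ (ball x ((1 / 2) ^ k * D)) *
          ((∫⁻ z in ball x ((1 / 2) ^ k * D), g z ∂μ) / μ (ball x ((1 / 2) ^ k * D))) :=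
        (ENNReal.mul_div_cancel h0 measure_ball_lt_top.ne).symm
    _ ≤ (ENNReal.ofReal (t ^ (finrank ℝ E : ℝ)) * μ (ball 0 (2 * D))) *
          radialMaximal μ (fun k => (1 / 2) ^ k * D) g x := by
        gcongr
        exact le_iSup (fun k : ℕ => (∫⁻ z in ball x ((1 / 2) ^ k * D), g z ∂μ) /
          μ (ball x ((1 / 2) ^ k * D))) k
    _ = _ := mul_assoc _ _ _

end ConvexMeanOscillation

/-! ### Sobolev–Poincaré for `C¹` functions. -/

section SmoothSobolevPoincare

variable {E : Type*} [NormedAddCommGroup E] [NormedSpace ℝ E] [FiniteDimensional ℝ E]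
  [MeasurableSpace E] [BorelSpace E] (μ : Measure E) [μ.IsAddHaarMeasure]

/-- The exponent `r` is the Sobolev conjugate of `p` in dimension `d`, or `p > d` and `r = ∞`. -/
def IsSobolevExponent (d p : ℝ) (r : ℝ≥0∞) : Prop :=
  p < d ∧ r = ENNReal.ofReal (d * p / (d - p)) ∨ d < p ∧ r = ∞

/-- Hedberg's argument with `a = d / p`: the oscillation at `x` is at most a multiple of `M x ^ (1 -
1 / a) * L ^ (1 / a)`. The bound `B` only ensures that the maximal function is finite; `K` is chosen
before it. -/
lemma exists_lintegral_oscillation_rpow_le {p : ℝ} (hp : 1 < p) (hpd : p < finrank ℝ E) {D : ℝ}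
    (hD : 0 < D) :
    ∃ K : ℝ≥0∞, K ≠ ∞ ∧ ∀ V : Set E, MeasurableSet V → Convex ℝ V →
      (∀ x ∈ V, ∀ y ∈ V, dist x y < D) → ∀ f : E → ℝ, ContDiff ℝ 1 f →
      ∀ B : ℝ≥0∞, B ≠ ∞ → (∀ x ∈ V, ‖fderiv ℝ f x‖ₑ ≤ B) →
      (∫⁻ x in V, (∫⁻ y in V, ‖f x - f y‖ₑ ∂μ) ^ (finrank ℝ E * p / (finrank ℝ E - p)) ∂μ) ^
        (1 / (finrank ℝ E * p / (finrank ℝ E - p))) ≤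
        K * (∫⁻ x in V, ‖fderiv ℝ f x‖ₑ ^ p ∂μ) ^ (1 / p) := by
  set d : ℝ := ((finrank ℝ E : ℕ) : ℝ) with hd
  set s : ℝ := d * p / (d - p) with hs
  have hp0 : 0 < p := by linarith
  have hd0 : 0 < d := by linarith
  have hdp : 0 < d - p := by linarith
  have hs0 : 0 < s := by positivity
  set a : ℝ := d / p with ha
  have ha1 : 1 < a := (one_lt_div hp0).2 hpd
  have ha0 : 0 < a := by linarith
  have hinv : 1 / a < 1 := (div_lt_one ha0).2 ha1
  have hp1 : 0 ≤ 1 - 1 / p := by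
    rw [sub_nonneg, div_le_one hp0]; exact hp.le
  -- The Sobolev exponent is exactly the power that turns `M ^ (1 - 1 / a)` into `M ^ p`, where the
  -- strong maximal estimate applies.
  have has : (1 - 1 / a) * s = p := by
    rw [ha, hs]; field_simp
  set Cs : ℝ≥0∞ := ENNReal.ofReal (p * (2 ^ (p - 1) / (p - 1))) *
    (2 * ENNReal.ofReal (4 ^ finrank ℝ E)) with hCs
  set k : ℝ≥0∞ := ENNReal.ofReal D * ENNReal.ofReal (1 + 1 / (a - 1)) with hk
  set b₁ := μ (ball 0 D)
  set b₂ := μ (ball 0 (2 * D))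
  have hb₁ : b₁ ≠ ∞ := measure_ball_lt_top.ne
  have hb₂ : b₂ ≠ ∞ := measure_ball_lt_top.ne
  refine ⟨k * ((b₁ ^ (1 - 1 / p)) ^ (1 / a) * (b₂ ^ p * Cs) ^ (1 / s)), ?_, ?_⟩
  · refine ENNReal.mul_ne_top (ENNReal.mul_ne_top (by simp) (by simp)) (ENNReal.mul_ne_top ?_ ?_)
    · exact ENNReal.rpow_ne_top_of_nonneg (by positivity)
        (ENNReal.rpow_ne_top_of_nonneg hp1 hb₁)
    · refine ENNReal.rpow_ne_top_of_nonneg (by positivity) (ENNReal.mul_ne_top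
        (ENNReal.rpow_ne_top_of_nonneg hp0.le hb₂) ?_)
      exact ENNReal.mul_ne_top (by simp) (ENNReal.mul_ne_top (by simp) (by simp))
  intro V hV hc hVD f hf B hB hfB
  have hcont : Continuous (fderiv ℝ f) := hf.continuous_fderiv one_ne_zero
  set g : E → ℝ≥0∞ := V.indicator (fun z => ‖fderiv ℝ f z‖ₑ) with hg
  have hgm : Measurable g := hcont.measurable.enorm.indicator hV
  have hgB : ∀ x, g x ≤ B := fun x => by
    by_cases hx : x ∈ V
    · simpa [hg, hx] using hfB x hx
    · simp [hg, hx]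
  have hgp : ∫⁻ z, g z ^ p ∂μ = ∫⁻ x in V, ‖fderiv ℝ f x‖ₑ ^ p ∂μ := by
    rw [← lintegral_indicator hV]
    congr 1 with x
    by_cases hx : x ∈ V
    · simp [hg, hx]
    · simp [hg, hx, hp0]
  rw [← hgp]
  set L := (∫⁻ z, g z ^ p ∂μ) ^ (1 / p) with hL
  have hLp : ∫⁻ z, g z ^ p ∂μ = L ^ p := by
    rw [hL, ← ENNReal.rpow_mul, one_div_mul_cancel hp0.ne', ENNReal.rpow_one]
  set M := radialMaximal μ (fun k => (1 / 2) ^ k * D) g with hM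
  have hMm : Measurable M := measurable_radialMaximal μ _ hgm
  have hpt : ∀ x ∈ V, (∫⁻ y in V, ‖f x - f y‖ₑ ∂μ) ≤
      k * ((b₂ * M x) ^ (1 - 1 / a) * (b₁ ^ (1 - 1 / p) * L) ^ (1 / a)) := by
    intro x hx
    refine (lintegral_enorm_sub_le_of_convex μ hV hc hVD hf hx).trans ?_
    rw [hk, mul_assoc]
    gcongr
    refine setLIntegral_rpow_neg_mul_le_rpow_mul_rpow ha1 ?_ ?_ ?_
    · exact ENNReal.mul_ne_top hb₂ ((radialMaximal_le_of_le μ hgB x).trans_lt hB.lt_top).ne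
    · intro t ht
      exact setLIntegral_ball_le_radialMaximal μ g x hD ht
    · intro t ht
      exact setLIntegral_ball_le_rpow_mul μ hgm hp x hD ht.1
  have hstrong : ∫⁻ x, M x ^ p ∂μ ≤ Cs * L ^ p := by
    rw [← hLp]
    refine lintegral_radialMaximal_rpow_le μ (R := D) (fun k => by positivity) (fun k => ?_) hgm
      hB hgB hp
    exact mul_le_of_le_one_left hD.le (pow_le_one₀ (by norm_num) (by norm_num))
  have hia : 0 ≤ 1 / a := by positivity
  calc (∫⁻ x in V, (∫⁻ y in V, ‖f x - f y‖ₑ ∂μ) ^ s ∂μ) ^ (1 / s)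
      ≤ (∫⁻ x in V, (k * (b₁ ^ (1 - 1 / p) * L) ^ (1 / a)) ^ s * (b₂ ^ p * M x ^ p) ∂μ) ^
          (1 / s) := by
        refine ENNReal.rpow_le_rpow (setLIntegral_mono' hV fun x hx => ?_) (by positivity)
        calc _ ≤ (k * ((b₂ * M x) ^ (1 - 1 / a) * (b₁ ^ (1 - 1 / p) * L) ^ (1 / a))) ^ s :=
              ENNReal.rpow_le_rpow (hpt x hx) hs0.le
          _ = (k * (b₁ ^ (1 - 1 / p) * L) ^ (1 / a)) ^ s * ((b₂ * M x) ^ (1 - 1 / a)) ^ s := by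
              rw [← ENNReal.mul_rpow_of_nonneg _ _ hs0.le]; congr 1; ring
          _ = _ := by
              rw [← ENNReal.rpow_mul, has, ENNReal.mul_rpow_of_nonneg _ _ hp0.le]
    _ ≤ ((k * (b₁ ^ (1 - 1 / p) * L) ^ (1 / a)) ^ s * (b₂ ^ p * (Cs * L ^ p))) ^ (1 / s) := by
        refine ENNReal.rpow_le_rpow ?_ (by positivity)
        rw [lintegral_const_mul _ ((hMm.pow_const p).const_mul _),
          lintegral_const_mul _ (hMm.pow_const p)]
        gcongr
        exact (setLIntegral_le_lintegral _ _).trans hstrong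
    _ = k * (b₁ ^ (1 - 1 / p) * L) ^ (1 / a) * ((b₂ ^ p * Cs) ^ (1 / s) * L ^ (1 - 1 / a)) := by
        have hsi : 0 ≤ 1 / s := by positivity
        rw [ENNReal.mul_rpow_of_nonneg _ _ hsi, ← ENNReal.rpow_mul, mul_one_div_cancel hs0.ne',
          ENNReal.rpow_one, ← mul_assoc (b₂ ^ p), ENNReal.mul_rpow_of_nonneg _ _ hsi,
          ← ENNReal.rpow_mul L, show p * (1 / s) = 1 - 1 / a by rw [← has]; field_simp]
    _ = k * ((b₁ ^ (1 - 1 / p)) ^ (1 / a) * (b₂ ^ p * Cs) ^ (1 / s)) *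
          (L ^ (1 / a) * L ^ (1 - 1 / a)) := by
        rw [ENNReal.mul_rpow_of_nonneg _ _ hia]; ring
    _ = _ := by
        rw [← ENNReal.rpow_add_of_nonneg _ _ hia (by linarith)]; simp

/-- For `p > d`, Hölder on balls leaves the weight `t ^ (-(d / p))`, integrable at 0, so no maximal
function is needed. -/
lemma exists_lintegral_oscillation_le {p : ℝ} (hp : 1 < p) (hpd : finrank ℝ E < p) {D : ℝ}
    (hD : 0 < D) :
    ∃ K : ℝ≥0∞, K ≠ ∞ ∧ ∀ V : Set E, MeasurableSet V → Convex ℝ V →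
      (∀ x ∈ V, ∀ y ∈ V, dist x y < D) → ∀ f : E → ℝ, ContDiff ℝ 1 f → ∀ x ∈ V,
      ∫⁻ y in V, ‖f x - f y‖ₑ ∂μ ≤ K * (∫⁻ x in V, ‖fderiv ℝ f x‖ₑ ^ p ∂μ) ^ (1 / p) := by
  set d : ℝ := ((finrank ℝ E : ℕ) : ℝ) with hd
  have hp0 : 0 < p := by linarith
  have ha1 : d / p < 1 := (div_lt_one hp0).2 hpd
  have hp1 : 0 ≤ 1 - 1 / p := by
    rw [sub_nonneg, div_le_one hp0]; exact hp.le
  set b₁ := μ (ball 0 D)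
  refine ⟨ENNReal.ofReal D * (ENNReal.ofReal (1 ^ (-(d / p) + 1) / (-(d / p) + 1)) *
    b₁ ^ (1 - 1 / p)), ?_, ?_⟩
  · exact ENNReal.mul_ne_top (by simp) (ENNReal.mul_ne_top (by simp)
      (ENNReal.rpow_ne_top_of_nonneg hp1 measure_ball_lt_top.ne))
  intro V hV hc hVD f hf x hx
  have hcont : Continuous (fderiv ℝ f) := hf.continuous_fderiv one_ne_zero
  set g : E → ℝ≥0∞ := V.indicator (fun z => ‖fderiv ℝ f z‖ₑ) with hg
  have hgm : Measurable g := hcont.measurable.enorm.indicator hV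
  have hgp : ∫⁻ z, g z ^ p ∂μ = ∫⁻ x in V, ‖fderiv ℝ f x‖ₑ ^ p ∂μ := by
    rw [← lintegral_indicator hV]
    congr 1 with x
    by_cases hx : x ∈ V
    · simp [hg, hx]
    · simp [hg, hx, hp0]
  rw [← hgp]
  refine (lintegral_enorm_sub_le_of_convex μ hV hc hVD hf hx).trans ?_
  rw [mul_assoc]
  gcongr
  calc ∫⁻ t in Ioo (0 : ℝ) 1, ENNReal.ofReal (t ^ (-d)) * ∫⁻ z in ball x (t * D), g z ∂μ
      ≤ ∫⁻ t in Ioo (0 : ℝ) 1, ENNReal.ofReal (t ^ (-(d / p))) *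
          (b₁ ^ (1 - 1 / p) * (∫⁻ z, g z ^ p ∂μ) ^ (1 / p)) := by
        refine setLIntegral_mono' measurableSet_Ioo fun t ht => ?_
        refine (mul_le_mul_right (setLIntegral_ball_le_rpow_mul μ hgm hp x hD ht.1) _).trans ?_
        rw [← mul_assoc, ← ENNReal.ofReal_mul (Real.rpow_nonneg ht.1.le _), ← Real.rpow_add ht.1,
          show -d + (finrank ℝ E - finrank ℝ E / p) = -(d / p) by rw [hd]; ring]
    _ = _ := by
        rw [lintegral_mul_const _ (by fun_prop), setLIntegral_Ioo_rpow (by linarith) zero_le_one,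
          mul_assoc]

/-- Sobolev–Poincaré inequality for `C¹` functions on convex sets, with a constant depending only
on bounds for the diameter and the volume. -/
theorem exists_const_eLpNorm_sub_le_of_contDiff {p : ℝ} (hp : 1 < p) {r : ℝ≥0∞}
    (hr : IsSobolevExponent (finrank ℝ E) p r) {D : ℝ} (hD : 0 < D) {m : ℝ≥0∞} (hm : m ≠ 0) :
    ∃ K : ℝ≥0∞, K ≠ ∞ ∧ ∀ V : Set E, MeasurableSet V → Convex ℝ V →
      (∀ x ∈ V, ∀ y ∈ V, dist x y < D) → m ≤ μ V → ∀ f : E → ℝ, ContDiff ℝ 1 f →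
      ∃ c : ℝ, eLpNorm (fun x => f x - c) r (μ.restrict V) ≤
        K * eLpNorm (fderiv ℝ f) (ENNReal.ofReal p) (μ.restrict V) := by
  have hp0 : 0 < p := by linarith
  obtain ⟨K, hK, hKV⟩ : ∃ K : ℝ≥0∞, K ≠ ∞ ∧ ∀ V : Set E, MeasurableSet V → Convex ℝ V →
      (∀ x ∈ V, ∀ y ∈ V, dist x y < D) → ∀ f : E → ℝ, ContDiff ℝ 1 f →
      ∀ B : ℝ≥0∞, B ≠ ∞ → (∀ x ∈ V, ‖fderiv ℝ f x‖ₑ ≤ B) →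
      eLpNorm (fun x => ∫⁻ y in V, ‖f x - f y‖ₑ ∂μ) r (μ.restrict V) ≤
        K * eLpNorm (fderiv ℝ f) (ENNReal.ofReal p) (μ.restrict V) := by
    have hL : ∀ (V : Set E) (f : E → ℝ), eLpNorm (fderiv ℝ f) (ENNReal.ofReal p) (μ.restrict V) =
        (∫⁻ x in V, ‖fderiv ℝ f x‖ₑ ^ p ∂μ) ^ (1 / p) := by
      intro V f
      rw [eLpNorm_eq_lintegral_rpow_enorm_toReal (by simpa using hp0) (by simp),
        ENNReal.toReal_ofReal hp0.le]
    rcases hr with ⟨hpd, rfl⟩ | ⟨hpd, rfl⟩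
    · obtain ⟨K, hK, h⟩ := exists_lintegral_oscillation_rpow_le μ hp hpd hD
      refine ⟨K, hK, fun V hV hc hVD f hf B hB hfB => ?_⟩
      have hs0 : 0 < finrank ℝ E * p / (finrank ℝ E - p) := by
        have : 0 < finrank ℝ E - p := by linarith
        have : (0 : ℝ) < finrank ℝ E := by linarith
        positivity
      rw [hL, eLpNorm_eq_lintegral_rpow_enorm_toReal (by simpa using hs0) (by simp),
        ENNReal.toReal_ofReal hs0.le]
      simpa using h V hV hc hVD f hf B hB hfB
    · obtain ⟨K, hK, h⟩ := exists_lintegral_oscillation_le μ hp hpd hD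
      refine ⟨K, hK, fun V hV hc hVD f hf B hB hfB => ?_⟩
      rw [hL, eLpNorm_exponent_top]
      refine eLpNormEssSup_le_of_ae_enorm_bound ?_
      filter_upwards [ae_restrict_mem hV] with x hx
      simpa using h V hV hc hVD f hf x hx
  refine ⟨m⁻¹ * K, ENNReal.mul_ne_top (ENNReal.inv_ne_top.2 hm) hK,
    fun V hV hc hVD hmV f hf => ⟨⨍ y in V, f y ∂μ, ?_⟩⟩
  have hVb : Bornology.IsBounded V :=
    isBounded_iff.2 ⟨D, fun x hx y hy => (hVD x hx y hy).le⟩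
  have hVfin : μ V ≠ ∞ := hVb.measure_lt_top.ne
  have hV0 : μ V ≠ 0 := fun h => hm (by simpa [h] using hmV)
  have hcont : Continuous (fderiv ℝ f) := hf.continuous_fderiv one_ne_zero
  obtain ⟨B, hB⟩ := (hVb.isCompact_closure.bddAbove_image hcont.norm.continuousOn)
  have hfB : ∀ x ∈ V, ‖fderiv ℝ f x‖ₑ ≤ ENNReal.ofReal B := by
    intro x hx
    rw [← ofReal_norm]
    exact ENNReal.ofReal_le_ofReal (hB (mem_image_of_mem _ (subset_closure hx)))
  have hint : IntegrableOn f V μ :=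
    (hf.continuous.continuousOn.integrableOn_compact hVb.isCompact_closure).mono_set subset_closure
  -- The deviation from the mean is the mean of `f x - f y`, and dividing by the volume costs at
  -- most `m⁻¹`.
  have hpt : ∀ x, ‖f x - ⨍ y in V, f y ∂μ‖ₑ ≤ (m⁻¹ : ℝ≥0∞) * ∫⁻ y in V, ‖f x - f y‖ₑ ∂μ := by
    intro x
    have : IsFiniteMeasure (μ.restrict V) := ⟨by simpa using hVfin.lt_top⟩
    have e : f x - ⨍ y in V, f y ∂μ = (μ.real V)⁻¹ • ∫ y in V, (f x - f y) ∂μ := by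
      rw [integral_sub (integrable_const _) hint, setAverage_eq, integral_const, smul_sub]
      have : μ.real V ≠ 0 := by simp [Measure.real, ENNReal.toReal_eq_zero_iff, hV0, hVfin]
      simp [this]
    rw [e, enorm_smul]
    gcongr
    · rw [enorm_inv (by simp [Measure.real, ENNReal.toReal_eq_zero_iff, hV0, hVfin])]
      rw [ENNReal.inv_le_inv, Real.enorm_of_nonneg (by positivity), Measure.real,
        ENNReal.ofReal_toReal hVfin]
      exact hmV
    · exact enorm_integral_le_lintegral_enorm _
  have hm' : ((m⁻¹).toNNReal : ℝ≥0∞) = m⁻¹ := ENNReal.coe_toNNReal (ENNReal.inv_ne_top.2 hm)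
  calc eLpNorm (fun x => f x - ⨍ y in V, f y ∂μ) r (μ.restrict V)
      ≤ m⁻¹ * eLpNorm (fun x => ∫⁻ y in V, ‖f x - f y‖ₑ ∂μ) r (μ.restrict V) := by
        rw [← hm']
        refine eLpNorm_le_mul_eLpNorm_of_ae_le_mul' (Filter.Eventually.of_forall fun x => ?_) r
        rw [hm']
        simpa using hpt x
    _ ≤ _ := by
        rw [mul_assoc]
        gcongr
        exact hKV V hV hc hVD f hf _ ENNReal.ofReal_ne_top hfB

end SmoothSobolevPoincare

/-! ### Jensen's inequality and passage to the limit. -/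

/-- Jensen's inequality for a weight `w` of total mass one. -/
lemma lintegral_mul_le_lintegral_mul_rpow {α : Type*} [MeasurableSpace α] {ν : Measure α}
    {w h : α → ℝ≥0∞} (hw : AEMeasurable w ν) (hh : AEMeasurable h ν) (hw1 : ∫⁻ a, w a ∂ν = 1)
    {p : ℝ} (hp : 1 ≤ p) :
    ∫⁻ a, w a * h a ∂ν ≤ (∫⁻ a, w a * h a ^ p ∂ν) ^ (1 / p) := by
  have hp0 : 0 < p := by linarith
  have hp1 : 0 ≤ 1 - 1 / p := by
    rw [sub_nonneg, div_le_one hp0]; exact hp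
  have key := ENNReal.lintegral_mul_norm_pow_le (hw.mul (hh.pow_const p)) hw
    (p := 1 / p) (q := 1 - 1 / p) (by positivity) hp1 (by ring)
  rw [hw1, ENNReal.one_rpow, mul_one] at key
  refine le_trans (le_of_eq ?_) key
  congr 1 with a
  simp only [Pi.mul_apply]
  rw [ENNReal.mul_rpow_of_nonneg _ _ (by positivity), ← ENNReal.rpow_mul,
    mul_one_div_cancel hp0.ne', ENNReal.rpow_one, mul_right_comm,
    ← ENNReal.rpow_add_of_nonneg _ _ (by positivity) hp1]
  simp

/-- A uniform bound for the oscillation of an almost everywhere convergent sequence around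
constants passes to the limit. -/
lemma exists_const_eLpNorm_sub_le_of_tendsto {α : Type*} [MeasurableSpace α] {ν : Measure α}
    [IsFiniteMeasure ν] (hν : ν ≠ 0) {r : ℝ≥0∞} (hr : r ≠ 0) {h : ℕ → α → ℝ} {f : α → ℝ}
    {V : ℕ → Set α} (hV : ∀ k, MeasurableSet (V k)) (hVx : ∀ᵐ x ∂ν, ∀ᶠ k in atTop, x ∈ V k)
    (hm : ∀ k, AEStronglyMeasurable (h k) ν)
    (hlim : ∀ᵐ x ∂ν, Tendsto (fun k => h k x) atTop (𝓝 (f x))) {M : ℝ≥0∞}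
    (hM : ∀ k, ∃ c : ℝ, eLpNorm (fun x => h k x - c) r (ν.restrict (V k)) ≤ M) :
    ∃ c : ℝ, eLpNorm (fun x => f x - c) r ν ≤ M := by
  rcases eq_or_ne M ∞ with rfl | hMtop
  · exact ⟨0, le_top⟩
  choose c hc using hM
  set w : ℕ → α → ℝ := fun k => (V k).indicator fun x => h k x - c k with hw
  have hwm : ∀ k, AEStronglyMeasurable (w k) ν := fun k =>
    ((hm k).sub aestronglyMeasurable_const).indicator (hV k)
  have hwM : ∀ k, eLpNorm (w k) r ν ≤ M := fun k => by
    rw [hw, eLpNorm_indicator_eq_eLpNorm_restrict (hV k)]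
    exact hc k
  -- Otherwise `|c k| → ∞`, so `min ‖w k x‖ N → N` almost everywhere, and lower semicontinuity of
  -- the norm bounds every constant `N` by `M` in `L^r`. This is impossible for a nonzero finite
  -- measure.
  have hbdd : ∃ R : ℝ, ∃ᶠ k in atTop, c k ∈ closedBall (0 : ℝ) R := by
    by_contra! hcon
    have hconst : ∀ N : ℕ, eLpNorm (fun _ : α => (N : ℝ)) r ν ≤ M := by
      intro N
      refine Lp.eLpNorm_le_of_ae_tendsto (u := atTop) (f := fun k x => min ‖w k x‖ N)
        (Eventually.of_forall fun k => ?_)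
        (fun k => (hwm k).norm.inf aestronglyMeasurable_const) ?_
      · refine (eLpNorm_mono fun x => ?_).trans (hwM k)
        rw [Real.norm_of_nonneg (by positivity)]
        exact min_le_left _ _
      · filter_upwards [hVx, hlim] with x hx hx'
        refine tendsto_const_nhds.congr' ?_
        have hclose : ∀ᶠ k in atTop, ‖h k x‖ < ‖f x‖ + 1 :=
          hx'.norm.eventually_lt_const (by linarith)
        filter_upwards [hx, hclose, hcon (‖f x‖ + 1 + N)] with k h1 h2 h3
        rw [mem_closedBall_zero_iff, not_le] at h3
        have h4 : w k x = h k x - c k := by simp [hw, h1]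
        have h5 := norm_sub_norm_le (c k) (h k x)
        rw [norm_sub_rev] at h5
        rw [h4, min_eq_right]
        linarith
    simp_rw [eLpNorm_const _ hr hν] at hconst
    set b := ν univ ^ (1 / r.toReal)
    have hb0 : b ≠ 0 := by
      have : 0 < b := ENNReal.rpow_pos (by simpa [pos_iff_ne_zero] using hν) (measure_ne_top _ _)
      exact this.ne'
    have hMb : M / b ≠ ∞ := ENNReal.div_ne_top hMtop hb0
    obtain ⟨N, hN⟩ := ENNReal.exists_nat_gt hMb
    have h1 := hconst N
    rw [Real.enorm_natCast] at h1
    have hbtop : b ≠ ∞ := ENNReal.rpow_ne_top_of_nonneg (by positivity) (measure_ne_top _ _)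
    rw [ENNReal.div_lt_iff (Or.inl hb0) (Or.inl hbtop)] at hN
    exact absurd h1 (not_le.2 hN)
  obtain ⟨R, hR⟩ := hbdd
  obtain ⟨c₀, -, φ, hφ, hcφ⟩ := tendsto_subseq_of_frequently_bounded isBounded_closedBall hR
  refine ⟨c₀, Lp.eLpNorm_le_of_ae_tendsto (u := atTop) (f := fun j => w (φ j))
    (Eventually.of_forall fun j => hwM _) (fun j => hwm _) ?_⟩
  filter_upwards [hVx, hlim] with x hx hx'
  refine ((hx'.comp hφ.tendsto_atTop).sub hcφ).congr' ?_
  filter_upwards [hφ.tendsto_atTop.eventually hx] with j hj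
  simp [hw, hj]

/-! ### Inner parallel sets. -/

section Inset

variable {E : Type*} [NormedAddCommGroup E] [NormedSpace ℝ E]

lemma Convex.setOf_closedBall_subset {U : Set E} (hU : Convex ℝ U) (δ : ℝ) :
    Convex ℝ {x | closedBall x δ ⊆ U} := by
  intro x hx y hy a b ha hb hab z hz
  have hz' : z - (a • x + b • y) ∈ closedBall (0 : E) δ := by
    rwa [mem_closedBall_zero_iff, ← dist_eq_norm]
  have h1 : x + (z - (a • x + b • y)) ∈ U := hx (by
    rwa [mem_closedBall, dist_eq_norm, add_sub_cancel_left, ← mem_closedBall_zero_iff])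
  have h2 : y + (z - (a • x + b • y)) ∈ U := hy (by
    rwa [mem_closedBall, dist_eq_norm, add_sub_cancel_left, ← mem_closedBall_zero_iff])
  have h3 := hU h1 h2 ha hb hab
  have : a • (x + (z - (a • x + b • y))) + b • (y + (z - (a • x + b • y))) = z := by
    have : z = (a + b) • z := by rw [hab, one_smul]
    have h4 : (a + b) • (z - (a • x + b • y)) = z - (a • x + b • y) := by rw [hab, one_smul]
    rw [smul_add, smul_add, add_add_add_comm, ← add_smul, h4, add_sub_cancel]
  rwa [this] at h3

lemma IsOpen.measurableSet_setOf_closedBall_subset [FiniteDimensional ℝ E] [MeasurableSpace E]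
    [BorelSpace E] {U : Set E} (hU : IsOpen U) {δ : ℝ} (hδ : 0 ≤ δ) :
    MeasurableSet {x | closedBall x δ ⊆ U} := by
  have : ProperSpace E := FiniteDimensional.proper ℝ E
  have h : {x | closedBall x δ ⊆ U} = (cthickening δ Uᶜ)ᶜ := by
    ext x
    rw [hU.isClosed_compl.cthickening_eq_biUnion_closedBall hδ]
    simp only [mem_compl_iff, mem_iUnion, not_exists, mem_closedBall]
    constructor
    · intro h y hy hxy
      exact hy (h (by rwa [mem_closedBall, dist_comm]))
    · intro h y hy
      by_contra hyU
      exact h y hyU (by rwa [mem_closedBall, dist_comm] at hy)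
  rw [h]
  exact isClosed_cthickening.measurableSet.compl

end Inset

/-! ### Mollification and the weak differential. -/

section Mollification

variable {n : ℕ} {U : Set (EuclideanSpace ℝ (Fin n))} {f : EuclideanSpace ℝ (Fin n) → ℝ}
  {df : EuclideanSpace ℝ (Fin n) → (EuclideanSpace ℝ (Fin n) →L[ℝ] ℝ)}

/-- The mollification of the extension of `f` by zero outside `U`. -/
noncomputable def mollify (φ : ContDiffBump (0 : EuclideanSpace ℝ (Fin n)))
    (U : Set (EuclideanSpace ℝ (Fin n))) (f : EuclideanSpace ℝ (Fin n) → ℝ) :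
    EuclideanSpace ℝ (Fin n) → ℝ :=
  φ.normed volume ⋆[ContinuousLinearMap.lsmul ℝ ℝ, volume] U.indicator f

variable (φ : ContDiffBump (0 : EuclideanSpace ℝ (Fin n)))

lemma contDiff_mollify (hU : MeasurableSet U) (hf : IntegrableOn f U) :
    ContDiff ℝ 1 (mollify φ U f) :=
  (φ.hasCompactSupport_normed (μ := volume)).contDiff_convolution_left _ (n := 1) φ.contDiff_normed
    ((integrable_indicator_iff hU).2 hf).locallyIntegrable

lemma integrable_normed_sub_smul_indicator {F : Type*} [NormedAddCommGroup F] [NormedSpace ℝ F]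
    {g : EuclideanSpace ℝ (Fin n) → F} (hU : MeasurableSet U) (hg : IntegrableOn g U)
    (x : EuclideanSpace ℝ (Fin n)) :
    Integrable fun y => φ.normed volume (x - y) • U.indicator g y := by
  obtain ⟨C, hC⟩ := (φ.hasCompactSupport_normed (μ := volume)).exists_bound_of_continuous
    (φ.continuous_normed (μ := volume))
  exact ((integrable_indicator_iff hU).2 hg).bdd_smul C
    (((φ.continuous_normed (μ := volume)).comp (continuous_const.sub continuous_id)).aestronglyMeasurable)
    (Eventually.of_forall fun y => hC _)

/-- The derivative falls on the kernel. Since the closed ball lies in `U`, `y ↦ φ.normed volume (x -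
y)` is an admissible test function; the sign from reflecting the variable cancels the one in the
weak derivative identity. -/
lemma fderiv_mollify (hU : MeasurableSet U) (hf : IntegrableOn f U) (hdf : IntegrableOn df U)
    (hw : HasWeakDeriv U f df) {x : EuclideanSpace ℝ (Fin n)} (hx : closedBall x φ.rOut ⊆ U) :
    fderiv ℝ (mollify φ U f) x = ∫ y, φ.normed volume (x - y) • U.indicator df y := by
  have hloc := ((integrable_indicator_iff hU).2 hf).locallyIntegrable
  have hder := (φ.hasCompactSupport_normed (μ := volume)).hasFDerivAt_convolution_left (μ := volume)
    (ContinuousLinearMap.lsmul ℝ ℝ) (φ.contDiff_normed (n := 1)) hloc x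
  have hexist := (φ.hasCompactSupport_normed (μ := volume)).fderiv (𝕜 := ℝ)
    |>.convolutionExists_left ((ContinuousLinearMap.lsmul ℝ ℝ).precompL (EuclideanSpace ℝ (Fin n)))
    ((φ.contDiff_normed (n := 1)).continuous_fderiv one_ne_zero) hloc x
  rw [mollify, hder.fderiv, convolution_eq_swap]
  ext v
  rw [ContinuousLinearMap.integral_apply hexist.integrable_swap,
    ContinuousLinearMap.integral_apply (integrable_normed_sub_smul_indicator φ hU hdf x)]
  set ψ : EuclideanSpace ℝ (Fin n) → ℝ := fun y => φ.normed volume (x - y) with hψ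
  have hψs : ContDiff ℝ (⊤ : ℕ∞) ψ := (φ.contDiff_normed (n := ⊤)).comp (contDiff_const.sub contDiff_id)
  have hψt : tsupport ψ ⊆ closedBall x φ.rOut := by
    refine closure_minimal (fun y hy => ?_) isClosed_closedBall
    have : x - y ∈ Function.support (φ.normed volume) := hy
    rw [φ.support_normed_eq, mem_ball_zero_iff] at this
    rw [mem_closedBall, dist_comm, dist_eq_norm]
    exact this.le
  have hψc : HasCompactSupport ψ :=
    HasCompactSupport.of_support_subset_isCompact (isCompact_closedBall x φ.rOut)
      (subset_closure.trans hψt)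
  have hψd : ∀ y, fderiv ℝ ψ y v = - fderiv ℝ (φ.normed volume) (x - y) v := by
    intro y
    have h1 : HasFDerivAt (fun y => x - y)
        (-ContinuousLinearMap.id ℝ (EuclideanSpace ℝ (Fin n))) y :=
      (hasFDerivAt_id y).const_sub x
    have h2 := (((φ.contDiff_normed (μ := volume) (n := 1)).differentiable one_ne_zero)
      (x - y)).hasFDerivAt.comp y h1
    have h3 : fderiv ℝ ψ y = _ := h2.fderiv
    rw [h3]
    simp
  have hweak := hw.integral_eq ψ hψs hψc (hψt.trans hx) v
  have e1 : ∫ y, ((ContinuousLinearMap.lsmul ℝ ℝ).precompL (EuclideanSpace ℝ (Fin n))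
      (fderiv ℝ (φ.normed volume) (x - y)) (U.indicator f y)) v =
      - ∫ y in U, f y * fderiv ℝ ψ y v := by
    rw [← integral_indicator hU, ← integral_neg]
    congr 1 with y
    by_cases hy : y ∈ U
    · simp [hy, hψd, ContinuousLinearMap.precompL_apply, mul_comm]
    · simp [hy]
  have e2 : ∫ y, (φ.normed volume (x - y) • U.indicator df y) v =
      ∫ y in U, df y v * ψ y := by
    rw [← integral_indicator hU]
    congr 1 with y
    by_cases hy : y ∈ U
    · simp [hy, hψ, mul_comm]
    · simp [hy]
  rw [e1, hweak, neg_neg, e2]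

lemma lintegral_ofReal_normed : ∫⁻ y, ENNReal.ofReal (φ.normed volume y) = 1 := by
  rw [← ofReal_integral_eq_lintegral_ofReal φ.integrable_normed
    (Eventually.of_forall φ.nonneg_normed), φ.integral_normed, ENNReal.ofReal_one]

/-- Jensen with the kernel as a probability density in `y`, then Tonelli, the kernel having mass one
in `x` too. -/
lemma lintegral_enorm_integral_normed_smul_rpow_le {F : Type*} [NormedAddCommGroup F]
    [NormedSpace ℝ F] {g : EuclideanSpace ℝ (Fin n) → F} (hU : MeasurableSet U)
    (hg : IntegrableOn g U) {p : ℝ} (hp : 1 ≤ p) :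
    ∫⁻ x, ‖∫ y, φ.normed volume (x - y) • U.indicator g y‖ₑ ^ p ≤ ∫⁻ y in U, ‖g y‖ₑ ^ p := by
  have hp0 : 0 < p := by linarith
  set h : EuclideanSpace ℝ (Fin n) → ℝ≥0∞ := fun y => ‖U.indicator g y‖ₑ with hh
  have hhm : AEMeasurable h := ((integrable_indicator_iff hU).2 hg).aestronglyMeasurable.enorm
  obtain ⟨w, hwφ⟩ : ∃ w : EuclideanSpace ℝ (Fin n) → ℝ≥0∞,
    w = fun y => ENNReal.ofReal (φ.normed volume y) := ⟨_, rfl⟩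
  have hwm : Measurable w := by
    rw [hwφ]
    exact (φ.continuous_normed (μ := volume)).measurable.ennreal_ofReal
  have hw1 : ∫⁻ y, w y = 1 := by
    rw [hwφ]
    exact lintegral_ofReal_normed φ
  have hpt : ∀ x, ‖∫ y, φ.normed volume (x - y) • U.indicator g y‖ₑ ^ p ≤
      ∫⁻ y, w (x - y) * h y ^ p := by
    intro x
    have h1 : ‖∫ y, φ.normed volume (x - y) • U.indicator g y‖ₑ ≤ ∫⁻ y, w (x - y) * h y := by
      refine (enorm_integral_le_lintegral_enorm _).trans (le_of_eq ?_)
      congr 1 with y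
      rw [enorm_smul, Real.enorm_of_nonneg (φ.nonneg_normed _), hwφ, hh]
    have h2 := lintegral_mul_le_lintegral_mul_rpow (ν := volume) (w := fun y => w (x - y)) (h := h)
      (hwm.comp (measurable_const.sub measurable_id)).aemeasurable hhm
      (by rw [lintegral_sub_left_eq_self w x, hw1]) hp
    calc _ ≤ ((∫⁻ y, w (x - y) * h y ^ p) ^ (1 / p)) ^ p :=
          ENNReal.rpow_le_rpow (h1.trans h2) hp0.le
      _ = _ := by rw [← ENNReal.rpow_mul, one_div_mul_cancel hp0.ne', ENNReal.rpow_one]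
  calc ∫⁻ x, ‖∫ y, φ.normed volume (x - y) • U.indicator g y‖ₑ ^ p
      ≤ ∫⁻ x, ∫⁻ y, w (x - y) * h y ^ p := lintegral_mono hpt
    _ = ∫⁻ y, ∫⁻ x, w (x - y) * h y ^ p := by
        rw [lintegral_lintegral_swap]
        refine AEMeasurable.mul ?_ ?_
        · exact (hwm.comp (measurable_fst.sub measurable_snd)).aemeasurable
        · exact (hhm.pow_const p).comp_snd
    _ = ∫⁻ y, h y ^ p := by
        congr 1 with y
        rw [lintegral_mul_const (f := fun x => w (x - y)) _ (hwm.comp (measurable_id.sub_const y)),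
          lintegral_sub_right_eq_self w y, hw1, one_mul]
    _ = ∫⁻ x in U, ‖g x‖ₑ ^ p := by
        rw [← lintegral_indicator hU]
        congr 1 with y
        by_cases hy : y ∈ U
        · simp [hh, hy]
        · simp [hh, hy, hp0]

lemma eLpNorm_fderiv_mollify_le (hU : MeasurableSet U) (hf : IntegrableOn f U)
    (hdf : IntegrableOn df U) (hw : HasWeakDeriv U f df) {p : ℝ} (hp : 1 ≤ p)
    {V : Set (EuclideanSpace ℝ (Fin n))} (hV : MeasurableSet V)
    (hVU : ∀ x ∈ V, closedBall x φ.rOut ⊆ U) :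
    eLpNorm (fderiv ℝ (mollify φ U f)) (ENNReal.ofReal p) (volume.restrict V) ≤
      eLpNorm df (ENNReal.ofReal p) (volume.restrict U) := by
  have hp0 : 0 < p := by linarith
  rw [eLpNorm_eq_lintegral_rpow_enorm_toReal (by simpa using hp0) (by simp),
    eLpNorm_eq_lintegral_rpow_enorm_toReal (by simpa using hp0) (by simp),
    ENNReal.toReal_ofReal hp0.le]
  refine ENNReal.rpow_le_rpow ?_ (by positivity)
  refine le_trans ((setLIntegral_mono' hV fun x hx => ?_).trans (setLIntegral_le_lintegral V _))
    (lintegral_enorm_integral_normed_smul_rpow_le φ hU hdf hp)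
  rw [fderiv_mollify φ hU hf hdf hw (hVU x hx)]

end Mollification

/-! ### Sobolev–Poincaré on `U` for Sobolev functions. -/

/-- Sobolev–Poincaré inequality on bounded convex open sets. -/
theorem exists_const_eLpNorm_sub_le_of_convex {n : ℕ} {U : Set (EuclideanSpace ℝ (Fin n))}
    (hU_open : IsOpen U) (hU_nonempty : U.Nonempty) (hU_bounded : Bornology.IsBounded U)
    (hU_convex : Convex ℝ U) {p : ℝ} (hp : 1 < p) {r : ℝ≥0∞} (hr : IsSobolevExponent n p r) :
    ∃ K : ℝ≥0∞, K ≠ ∞ ∧ ∀ (f : EuclideanSpace ℝ (Fin n) → ℝ)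
      (df : EuclideanSpace ℝ (Fin n) → (EuclideanSpace ℝ (Fin n) →L[ℝ] ℝ)),
      MemW1pWithDeriv U (ENNReal.ofReal p) f df →
      ∃ c : ℝ, eLpNorm (fun x => f x - c) r (volume.restrict U) ≤
        K * eLpNorm df (ENNReal.ofReal p) (volume.restrict U) := by
  have hUm := hU_open.measurableSet
  have hr0 : r ≠ 0 := by
    rcases hr with ⟨h, rfl⟩ | ⟨-, rfl⟩
    · have : 0 < (n : ℝ) - p := by linarith
      have : 0 < (n : ℝ) := by linarith
      simpa using by positivity
    · simp
  have hfin : IsFiniteMeasure (volume.restrict U) := ⟨by simpa using hU_bounded.measure_lt_top⟩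
  have hν : volume.restrict U ≠ 0 := by
    rw [Ne, Measure.restrict_eq_zero]
    exact (hU_open.measure_pos volume hU_nonempty).ne'
  obtain ⟨x₀, hx₀⟩ := hU_nonempty
  obtain ⟨ε₀, hε₀, hball⟩ := Metric.isOpen_iff.1 hU_open x₀ hx₀
  -- Every inset has `δ k ≤ ε`, so it contains `ball x₀ ε` because `2 * ε < ε₀`. This gives a volume
  -- bound uniform in `k`.
  set ε := ε₀ / 3 with hε
  have hε0 : 0 < ε := by positivity
  obtain ⟨D, hD⟩ := isBounded_iff.1 hU_bounded
  have hD0 : 0 ≤ D := by simpa using hD hx₀ hx₀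
  obtain ⟨K, hK, hKV⟩ := exists_const_eLpNorm_sub_le_of_contDiff
    (volume : Measure (EuclideanSpace ℝ (Fin n))) hp (r := r) (by simpa using hr)
    (D := D + 1) (by linarith) (m := volume (ball x₀ ε)) (measure_ball_pos _ _ hε0).ne'
  refine ⟨K, hK, fun f df hf => ?_⟩
  have hp1 : 1 ≤ ENNReal.ofReal p := by simpa using hp.le
  have hfi : IntegrableOn f U := hf.memLp.integrable hp1
  have hdfi : IntegrableOn df U := hf.memLp_deriv.integrable hp1
  set δ : ℕ → ℝ := fun k => ε / (k + 1) with hδ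
  have hδ0 : ∀ k, 0 < δ k := fun k => by positivity
  have hδε : ∀ k, δ k ≤ ε := fun k => div_le_self hε0.le (by linarith [k.cast_nonneg (α := ℝ)])
  have hδlim : Tendsto δ atTop (𝓝 0) := by
    have := (tendsto_one_div_add_atTop_nhds_zero_nat (𝕜 := ℝ)).const_mul ε
    simpa [hδ, div_eq_mul_inv] using this
  -- The ratio of outer to inner radius stays equal to 2, as the almost everywhere convergence of
  -- mollifications requires a bounded ratio.
  let φ : ℕ → ContDiffBump (0 : EuclideanSpace ℝ (Fin n)) := fun k =>
    ⟨δ k / 2, δ k, by have := hδ0 k; positivity, by linarith [hδ0 k]⟩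
  set V : ℕ → Set (EuclideanSpace ℝ (Fin n)) := fun k => {x | closedBall x (δ k) ⊆ U} with hV
  have hVm : ∀ k, MeasurableSet (V k) := fun k =>
    hU_open.measurableSet_setOf_closedBall_subset (hδ0 k).le
  have hVU : ∀ k, V k ⊆ U := fun k x hx => hx (mem_closedBall_self (hδ0 k).le)
  refine exists_const_eLpNorm_sub_le_of_tendsto hν hr0 (V := V) hVm ?_
    (h := fun k => mollify (φ k) U f) ?_ ?_ ?_
  · filter_upwards [ae_restrict_mem hUm] with x hx
    obtain ⟨η, hη, hηU⟩ := Metric.isOpen_iff.1 hU_open x hx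
    filter_upwards [hδlim.eventually_lt_const hη] with k hk
    exact (closedBall_subset_ball hk).trans hηU
  · exact fun k => (contDiff_mollify (φ k) hUm hfi).continuous.aestronglyMeasurable
  · have := ContDiffBump.ae_convolution_tendsto_right_of_locallyIntegrable
      (μ := (volume : Measure (EuclideanSpace ℝ (Fin n)))) (φ := φ) (l := atTop) (K := 2) hδlim
      (Eventually.of_forall fun k => by simp [φ]; linarith)
      ((integrable_indicator_iff hUm).2 hfi).locallyIntegrable
    filter_upwards [ae_restrict_of_ae this, ae_restrict_mem hUm] with x hx hxU
    simpa [hxU, mollify] using hx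
  · intro k
    obtain ⟨c, hc⟩ := hKV (V k) (hVm k) (hU_convex.setOf_closedBall_subset _)
      (fun x hx y hy => (hD (hVU k hx) (hVU k hy)).trans_lt (by linarith))
      (measure_mono fun x hx => (closedBall_subset_ball' (by
        have := hδε k
        have := mem_ball.1 hx
        linarith)).trans hball) (mollify (φ k) U f) (contDiff_mollify (φ k) hUm hfi)
    refine ⟨c, ?_⟩
    rw [Measure.restrict_restrict (hVm k), inter_eq_left.2 (hVU k)]
    refine hc.trans ?_
    gcongr
    exact eLpNorm_fderiv_mollify_le (φ k) hUm hfi hdfi hf.hasWeakDeriv hp.le (hVm k)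
      fun x hx => hx

lemma MemW1pWithDeriv.mono_exponent {n : ℕ} {U : Set (EuclideanSpace ℝ (Fin n))}
    [IsFiniteMeasure (volume.restrict U)] {p p' : ℝ≥0∞}
    {f : EuclideanSpace ℝ (Fin n) → ℝ}
    {df : EuclideanSpace ℝ (Fin n) → (EuclideanSpace ℝ (Fin n) →L[ℝ] ℝ)}
    (h : MemW1pWithDeriv U p f df) (hpp : p' ≤ p) : MemW1pWithDeriv U p' f df :=
  ⟨h.memLp.mono_exponent hpp, h.hasWeakDeriv, h.memLp_deriv.mono_exponent hpp⟩

/-- Sobolev–Poincaré inequality on bounded convex open sets for all admissible exponents, with an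
exponent dominating two prescribed ones. -/
lemma exists_exponent_ge_and_const_eLpNorm_sub_le {n : ℕ} (hn : 2 ≤ n)
    {U : Set (EuclideanSpace ℝ (Fin n))} (hU_open : IsOpen U) (hU_nonempty : U.Nonempty)
    (hU_bounded : Bornology.IsBounded U) (hU_convex : Convex ℝ U) {p : ℝ} (hp : 1 < p)
    {r : ℝ≥0∞} (hr : p < (n : ℝ) → ENNReal.ofReal (1 / p - 1 / (n : ℝ)) ≤ 1 / r)
    (hr_crit : p = (n : ℝ) → r ≠ ∞) {σ : ℝ} (hσ : p < (n : ℝ) → σ * (n - p) ≤ n * p) :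
    ∃ r' : ℝ≥0∞, r ≤ r' ∧ ENNReal.ofReal σ ≤ r' ∧ ∃ K : ℝ≥0∞, K ≠ ∞ ∧
      ∀ (f : EuclideanSpace ℝ (Fin n) → ℝ)
        (df : EuclideanSpace ℝ (Fin n) → (EuclideanSpace ℝ (Fin n) →L[ℝ] ℝ)),
        MemW1pWithDeriv U (ENNReal.ofReal p) f df →
        ∃ c : ℝ, eLpNorm (fun x => f x - c) r' (volume.restrict U) ≤
          K * eLpNorm df (ENNReal.ofReal p) (volume.restrict U) := by
  have hn' : (2 : ℝ) ≤ n := by exact_mod_cast hn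
  rcases lt_trichotomy p n with h | h | h
  · have hnp : 0 < n - p := by linarith
    refine ⟨ENNReal.ofReal (n * p / (n - p)), ?_, ?_,
      exists_const_eLpNorm_sub_le_of_convex hU_open hU_nonempty hU_bounded hU_convex hp
        (Or.inl ⟨h, rfl⟩)⟩
    · have h1 := hr h
      rw [one_div r, ENNReal.le_inv_iff_le_inv, ← ENNReal.ofReal_inv_of_pos] at h1
      · convert h1 using 2
        field_simp
      · rw [sub_pos]
        exact one_div_lt_one_div_of_lt (by linarith) h
    · exact ENNReal.ofReal_le_ofReal ((le_div_iff₀ hnp).2 (hσ h))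
  · set t : ℝ := max (max r.toReal σ) 3 with ht
    have ht3 : 3 ≤ t := le_max_right _ _
    set p' : ℝ := n * t / (n + t) with hp'
    have hnt : 0 < n + t := by linarith
    have hp'1 : 1 < p' := by
      rw [hp', one_lt_div hnt]; nlinarith
    have hp'n : p' < n := by
      rw [hp', div_lt_iff₀ hnt]; nlinarith
    have hp't : n * p' / (n - p') = t := by
      have : n - p' ≠ 0 := by linarith
      rw [div_eq_iff this, hp']
      field_simp
      ring
    obtain ⟨K, hK, hKf⟩ := exists_const_eLpNorm_sub_le_of_convex hU_open hU_nonempty hU_bounded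
      hU_convex hp'1 (r := ENNReal.ofReal t) (Or.inl ⟨hp'n, by rw [hp't]⟩)
    have hfin : IsFiniteMeasure (volume.restrict U) := ⟨by simpa using hU_bounded.measure_lt_top⟩
    have hpp : ENNReal.ofReal p' ≤ ENNReal.ofReal p := ENNReal.ofReal_le_ofReal (by linarith)
    refine ⟨ENNReal.ofReal t, ?_, ENNReal.ofReal_le_ofReal
      ((le_max_right _ _).trans (le_max_left _ _)), K * volume.restrict U univ ^
        (1 / (ENNReal.ofReal p').toReal - 1 / (ENNReal.ofReal p).toReal),
      ENNReal.mul_ne_top hK (ENNReal.rpow_ne_top_of_nonneg ?_ (measure_ne_top _ _)), ?_⟩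
    · rw [← ENNReal.ofReal_toReal (hr_crit h)]
      exact ENNReal.ofReal_le_ofReal ((le_max_left _ _).trans (le_max_left _ _))
    · rw [ENNReal.toReal_ofReal (by linarith), ENNReal.toReal_ofReal (by linarith), sub_nonneg]
      exact one_div_le_one_div_of_le (by linarith) (by linarith)
    · intro f df hf
      obtain ⟨c, hc⟩ := hKf f df (hf.mono_exponent hpp)
      refine ⟨c, hc.trans ?_⟩
      rw [mul_assoc, mul_comm (_ ^ _)]
      gcongr
      exact eLpNorm_le_eLpNorm_mul_rpow_measure_univ hpp hf.memLp_deriv.aestronglyMeasurable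
  · exact ⟨∞, le_top, le_top, exists_const_eLpNorm_sub_le_of_convex hU_open hU_nonempty hU_bounded
      hU_convex hp (Or.inr ⟨h, rfl⟩)⟩

/-! ### Replacing the constant by the weighted mean. -/

/-- Hölder's inequality for the average of `g` against a density `ω` of total mass one. -/
lemma lintegral_enorm_mul_enorm_le_of_density {α : Type*} [MeasurableSpace α] {ν : Measure α}
    {ω g : α → ℝ} (hω : AEStronglyMeasurable ω ν) (hg : AEStronglyMeasurable g ν)
    (hω1 : ∫⁻ x, ‖ω x‖ₑ ∂ν = 1) {q q' s : ℝ} (hq : q.HolderConjugate q') (hs : 1 ≤ s) :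
    ∫⁻ x, ‖ω x‖ₑ * ‖g x‖ₑ ∂ν ≤
      eLpNorm ω (ENNReal.ofReal q) ν ^ (1 / s) * eLpNorm g (ENNReal.ofReal (s * q')) ν := by
  have hs0 : 0 < s := by linarith
  have hq0 := hq.pos
  have hq'0 := hq.symm.pos
  have hsq : 0 < s * q' := by positivity
  have h1 := lintegral_mul_le_lintegral_mul_rpow hω.enorm hg.enorm hω1 hs
  have h2 := ENNReal.lintegral_mul_le_Lp_mul_Lq ν hq hω.enorm (hg.enorm.pow_const s)
  simp only [Pi.mul_apply] at h2
  refine (h1.trans (ENNReal.rpow_le_rpow h2 (by positivity))).trans (le_of_eq ?_)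
  rw [eLpNorm_eq_lintegral_rpow_enorm_toReal (by simpa using hq0) (by simp),
    eLpNorm_eq_lintegral_rpow_enorm_toReal (by simpa using hsq) (by simp),
    ENNReal.toReal_ofReal hq0.le, ENNReal.toReal_ofReal hsq.le,
    ENNReal.mul_rpow_of_nonneg _ _ (by positivity)]
  simp_rw [← ENNReal.rpow_mul]
  congr 2
  field_simp

theorem lemma2 (n : ℕ) (hn : 2 ≤ n) (U : Set (EuclideanSpace ℝ (Fin n)))
    (hU_open : IsOpen U) (hU_nonempty : U.Nonempty) (hU_bounded : Bornology.IsBounded U)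
    (hU_convex : Convex ℝ U) (hU_smooth : HasSmoothBoundary U)
    (p q : ℝ) (hp₁ : 1 < p) (hq₁ : 1 < q)
    (hp : (n : ℝ) / ((n : ℝ) - 1) ≤ p) (hq : (n : ℝ) / 2 < q)
    (r : ℝ≥0∞) (hr₁ : 1 ≤ r)
    (hr : p < (n : ℝ) → ENNReal.ofReal (1 / p - 1 / (n : ℝ)) ≤ 1 / r)
    (hr_crit : p = (n : ℝ) → r ≠ ∞) :
    ∃ C : ℝ, 0 < C ∧
      ∀ ω : EuclideanSpace ℝ (Fin n) → ℝ,
        MemLp ω (ENNReal.ofReal q) (volume.restrict U) →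
        (∀ᵐ x ∂(volume.restrict U), 0 ≤ ω x) →
        ∫ x in U, ω x = 1 →
      ∀ (f : EuclideanSpace ℝ (Fin n) → ℝ)
        (df : EuclideanSpace ℝ (Fin n) → (EuclideanSpace ℝ (Fin n) →L[ℝ] ℝ)),
        MemW1pWithDeriv U (ENNReal.ofReal p) f df →
        Integrable (fun y => f y * ω y) (volume.restrict U) ∧
        eLpNorm (fun x => f x - ∫ y in U, f y * ω y) r (volume.restrict U) ≤
          ENNReal.ofReal C *
            eLpNorm ω (ENNReal.ofReal q) (volume.restrict U) ^
              ((n : ℝ) / (((n : ℝ) - 1) * p)) *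
            eLpNorm df (ENNReal.ofReal p) (volume.restrict U) := by
  have hn' : (2 : ℝ) ≤ n := by exact_mod_cast hn
  have hfin : IsFiniteMeasure (volume.restrict U) := ⟨by simpa using hU_bounded.measure_lt_top⟩
  set ν := volume.restrict U with hν
  have hν0 : ν ≠ 0 := by
    rw [hν, Ne, Measure.restrict_eq_zero]
    exact (hU_open.measure_pos volume hU_nonempty).ne'
  -- Chosen so that `1 / s` is the required power of the norm of `ω`; the lower bound on `p` says
  -- precisely `s ≥ 1`, as Jensen needs.
  set s : ℝ := p * (n - 1) / n with hs
  have hn1 : (0 : ℝ) < n - 1 := by linarith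
  have hpn : (n : ℝ) ≤ p * (n - 1) := (div_le_iff₀ hn1).1 hp
  have hs1 : 1 ≤ s := by rw [hs, one_le_div (by linarith)]; exact hpn
  have hsexp : (n : ℝ) / (((n : ℝ) - 1) * p) = 1 / s := by
    rw [hs]; field_simp
  have hqq := Real.HolderConjugate.conjExponent hq₁
  set q' := q.conjExponent with hq'
  have hq'0 := hqq.symm.pos
  obtain ⟨r', hrr', hσr', K, hK, hKf⟩ := exists_exponent_ge_and_const_eLpNorm_sub_le hn hU_open
    hU_nonempty hU_bounded hU_convex hp₁ hr hr_crit (σ := s * q') (by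
      intro _
      have hq1 : 0 < q - 1 := by linarith
      rw [hs, hq', Real.conjExponent, div_mul_div_comm, div_mul_eq_mul_div,
        div_le_iff₀ (by positivity)]
      -- After clearing denominators, this is the condition that `s * q'` not exceed the Sobolev
      -- exponent. It holds since `p * (n - 1) ≥ n` and `q > n / 2` make the right side at least `q
      -- * (2 * n) ≥ n * n`.
      have h1 : (n : ℝ) * n ≤ q * (n + p * (n - 1)) := by nlinarith
      have hp0 : 0 < p := by linarith
      nlinarith)
  set α : ℝ := 1 / s with hα
  have hα0 : 0 ≤ α := by positivity
  set κ := ν univ ^ (1 / (ENNReal.ofReal (s * q')).toReal - 1 / r'.toReal) with hκ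
  set κ' := ν univ ^ (1 / r.toReal - 1 / r'.toReal) with hκ'
  set κ₁ := ν univ ^ (1 / r.toReal) with hκ₁
  set κ₂ := (ν univ ^ (1 / (1 : ℝ≥0∞).toReal - 1 / (ENNReal.ofReal q).toReal)) ^ α with hκ₂
  have hpow : ∀ x : ℝ, ν univ ^ x ≠ ∞ := fun x =>
    ENNReal.rpow_ne_top_of_ne_zero (by simpa using hν0) (measure_ne_top _ _)
  set C := κ₂ * (K * κ') + K * κ * κ₁ with hC
  have hCtop : C ≠ ∞ := by
    refine ENNReal.add_ne_top.2 ⟨ENNReal.mul_ne_top (ENNReal.rpow_ne_top_of_nonneg hα0 (hpow _))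
      (ENNReal.mul_ne_top hK (hpow _)), ENNReal.mul_ne_top (ENNReal.mul_ne_top hK (hpow _))
      (hpow _)⟩
  -- Adding 1 makes the constant strictly positive in all cases.
  refine ⟨C.toReal + 1, by positivity, fun ω hω hω0 hω1 f df hf => ?_⟩
  obtain ⟨c, hc⟩ := hKf f df hf
  set N := eLpNorm df (ENNReal.ofReal p) ν with hN
  set W := eLpNorm ω (ENNReal.ofReal q) ν with hW
  have hNtop : N ≠ ∞ := hf.memLp_deriv.eLpNorm_ne_top
  have hWtop : W ≠ ∞ := hω.eLpNorm_ne_top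
  have hq1 : 1 ≤ ENNReal.ofReal q := by simpa using hq₁.le
  have hωi : Integrable ω ν := hω.integrable hq1
  have hωe : ∫⁻ x, ‖ω x‖ₑ ∂ν = 1 := by
    rw [← ofReal_integral_norm_eq_lintegral_enorm hωi, ← ENNReal.ofReal_one, ← hω1]
    congr 1
    refine integral_congr_ae ?_
    filter_upwards [hω0] with x hx
    exact Real.norm_of_nonneg hx
  have hgm : AEStronglyMeasurable (fun x => f x - c) ν :=
    hf.memLp.aestronglyMeasurable.sub aestronglyMeasurable_const
  have hA : ∫⁻ x, ‖ω x‖ₑ * ‖f x - c‖ₑ ∂ν ≤ W ^ α * (K * N * κ) := by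
    refine (lintegral_enorm_mul_enorm_le_of_density hω.aestronglyMeasurable hgm hωe hqq
      hs1).trans ?_
    gcongr
    refine (eLpNorm_le_eLpNorm_mul_rpow_measure_univ hσr' hgm).trans ?_
    gcongr
  have hAtop : W ^ α * (K * N * κ) ≠ ∞ := ENNReal.mul_ne_top
    (ENNReal.rpow_ne_top_of_nonneg hα0 hWtop)
    (ENNReal.mul_ne_top (ENNReal.mul_ne_top hK hNtop) (hpow _))
  have hgω : Integrable (fun x => (f x - c) * ω x) ν := by
    refine ⟨hgm.mul hω.aestronglyMeasurable, lt_of_le_of_lt (le_of_eq ?_)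
      (hA.trans_lt hAtop.lt_top)⟩
    congr 1 with x
    rw [enorm_mul, mul_comm]
  have hsplit : ∀ x, f x * ω x = (f x - c) * ω x + c * ω x := fun x => by ring
  have hfω : Integrable (fun x => f x * ω x) ν := by
    simp_rw [hsplit]
    exact hgω.add (hωi.const_mul c)
  refine ⟨hfω, ?_⟩
  set e := ∫ x, (f x - c) * ω x ∂ν with he
  have hmean : ∫ y, f y * ω y ∂ν = e + c := by
    simp_rw [hsplit]
    rw [integral_add hgω (hωi.const_mul c), integral_const_mul, hω1, mul_one]
  have heA : ‖e‖ₑ ≤ W ^ α * (K * N * κ) := by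
    refine (enorm_integral_le_lintegral_enorm _).trans (le_trans (le_of_eq ?_) hA)
    congr 1 with x
    rw [enorm_mul, mul_comm]
  -- Since `ω` has `L¹` norm 1 on a set of finite measure, its `L^q` norm is bounded below; this
  -- supplies the missing power of `W` in the term `K * N * κ'`.
  have hone : 1 ≤ W ^ α * κ₂ := by
    have h1 := eLpNorm_le_eLpNorm_mul_rpow_measure_univ hq1 hω.aestronglyMeasurable
    rw [eLpNorm_one_eq_lintegral_enorm, hωe] at h1
    have h2 := ENNReal.rpow_le_rpow h1 hα0
    rwa [ENNReal.one_rpow, ENNReal.mul_rpow_of_nonneg _ _ hα0] at h2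
  have hr0 : r ≠ 0 := (zero_lt_one.trans_le hr₁).ne'
  rw [hmean, hsexp]
  calc eLpNorm (fun x => f x - (e + c)) r ν
      = eLpNorm ((fun x => f x - c) - fun _ => e) r ν := by
        congr 1 with x
        simp only [Pi.sub_apply]
        ring
    _ ≤ eLpNorm (fun x => f x - c) r ν + eLpNorm (fun _ => e) r ν :=
        eLpNorm_sub_le hgm aestronglyMeasurable_const hr₁
    _ ≤ K * N * κ' + W ^ α * (K * N * κ) * κ₁ := by
        gcongr
        · refine (eLpNorm_le_eLpNorm_mul_rpow_measure_univ hrr' hgm).trans ?_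
          gcongr
        · rw [eLpNorm_const _ hr0 hν0]
          gcongr
    _ ≤ W ^ α * κ₂ * (K * N * κ') + W ^ α * (K * N * κ) * κ₁ := by
        exact add_le_add_left (le_mul_of_one_le_left zero_le hone) _
    _ = C * W ^ α * N := by rw [hC]; ring
    _ ≤ ENNReal.ofReal (C.toReal + 1) * W ^ α * N := by
        gcongr
        rw [← ENNReal.ofReal_toReal hCtop]
        apply ENNReal.ofReal_le_ofReal
        rw [ENNReal.toReal_ofReal ENNReal.toReal_nonneg]
        linarith
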